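/- **Setting.** Let $d\ge 1$. Place $n\ge 1$ points $X_1,\dots,X_n$ independently and uniformly at random in $[0,1)^d$ and join two of them by an edge iff their Euclidean distance is at most $r>0$; let $m$ be the number of edges. The graph is generated by $P\ge 1$ processing elements (PEs) without communication. Let $b$ be the least integer with $k:=2^{db}\ge P$. The cube is recursively halved in all dimensions $b$ times, giving $k$ chunks (subcubes) of side $2^{-b}$, which are assigned to the PEs in $P$ consecutive pieces of $\lfloor k/P\rfloor$ or $\lceil k/P\rceil$ chunks along the Z-order curve. Every chunk is divided into $g^d$ equal cells, where $g=\max\bigl(1,\lfloor 2^{-b}/\max(r,n^{-1/d})\rfloor\bigr)$. Two cells (possibly equal) are neighbors if their integer coordinates differ by at most $\lceil r/w\rceil$ in every dimension, where $w=2^{-b}/g$ is the side length of a cell (so by at most $1$ whenever $r\le 2^{-b}$). The cells of a PE's chunks are its local cells, and the points in them its local points. The work of a PE is the total number of the following steps: for every chunk containing a local cell or a neighbor of one, $b(2^d-1)$ binomial variates for the recursion and $g^d$ binomial variates for the cell occupancies; one step for each pair of a local cell and a neighbor of it; one step for each point that lies in a local cell or in a neighbor of one; and one step for each distance computation, i.e.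 for each unordered pair of distinct points in neighboring cells at least one of which is local to the PE. **Theorem.** For every $d\ge1$ and every constant $c>0$ there are constants $a=a(c,d)>0$ and $K=K(c,d)>0$ such that for all $n\ge1$, $P\ge1$ and $r>0$ with $n\ge a\,P^2\log^3P$ the following holds: with probability at least $1-n^{-c}$, every PE performs work at most $K\,(m+n)/P$ and also at most $K\,(\mathbf E[m]+n)/P$. -/

import Mathlib

open MeasureTheory

/-! Random geometric graphs and the work of the communication-free distributed generator. -/

noncomputable section

namespace RGG

/-- Euclidean distance of two points of `ℝ^d`. -/
def eucl {d : ℕ} (x y : Fin d → ℝ) : ℝ := √(∑ j, (x j - y j) ^ 2)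

/-- The geometric graph on the points `X 0, …, X (n-1)`: two vertices are adjacent iff their
Euclidean distance is at most `r`. -/
def geomGraph {n d : ℕ} (r : ℝ) (X : Fin n → Fin d → ℝ) : SimpleGraph (Fin n) where
  Adj u v := u ≠ v ∧ eucl (X u) (X v) ≤ r
  symm := ⟨fun u v h => ⟨h.1.symm, by
    have h2 := h.2
    simp only [eucl] at h2 ⊢
    simpa only [sub_sq_comm] using h2⟩⟩
  loopless := ⟨fun _ h => h.1 rfl⟩

/-- The number `m` of edges. -/
def numEdges {n d : ℕ} (r : ℝ) (X : Fin n → Fin d → ℝ) : ℕ := (geomGraph r X).edgeSet.ncard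

/-- The law of `n` independent points, each uniform in the cube `[0,1)^d`. -/
def uniformPoints (n d : ℕ) : Measure (Fin n → Fin d → ℝ) :=
  Measure.pi fun _ : Fin n => Measure.pi fun _ : Fin d => volume.restrict (Set.Ico (0 : ℝ) 1)

/-- The expected number of edges. -/
def expEdges (n d : ℕ) (r : ℝ) : ℝ := ∫ X, (numEdges r X : ℝ) ∂(uniformPoints n d)

/-- Input of the generator: dimension `d`, number of vertices `n`, number of PEs `P`,
threshold radius `r`. -/
structure Params where
  d : ℕ
  n : ℕ
  P : ℕ
  r : ℝ

namespace Params

variable (p : Params)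

/-- The depth `b` of the recursion: the least `b` with `2^(d*b) ≥ P`. -/
def depth : ℕ := Nat.clog (2 ^ p.d) p.P

/-- The number `k = 2^(d*b)` of chunks; the chunks are the subcubes of side length `2^(-b)`. -/
def numChunks : ℕ := 2 ^ (p.d * p.depth)

/-- Every chunk is divided into `g^d` cells, where `g` is the largest number for which the side
length `2^(-b) / g` of a cell is at least `max(r, n^(-1/d))`; if already the chunk has a smaller
side length, the chunk is a single cell. -/
def cellsPerChunkDim : ℕ :=
  max 1 ⌊((1 : ℝ) / 2 ^ p.depth) / max p.r ((p.n : ℝ) ^ (-(1 : ℝ) / p.d))⌋₊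

/-- The number `G = 2^b * g` of cells along one dimension; a cell has side length `1 / G`. -/
def cellsPerDim : ℕ := 2 ^ p.depth * p.cellsPerChunkDim

/-- How many cells in each direction a distance `r` can span: `⌈r / (1/G)⌉`. It is `1` whenever
the side length of a cell is at least `r`, that is, whenever `r` is at most the side length of
a chunk. -/
def reach : ℕ := ⌈p.r * p.cellsPerDim⌉₊

/-- All cells, given by their integer coordinates. -/
def cells : Finset (Fin p.d → ℕ) := Fintype.piFinset fun _ => Finset.range p.cellsPerDim

/-- The cell that contains the point `x`. -/
def cellOf (x : Fin p.d → ℝ) : Fin p.d → ℕ := fun j => ⌊x j * p.cellsPerDim⌋₊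

/-- The chunk that contains the cell `C`. -/
def chunkOf (C : Fin p.d → ℕ) : Fin p.d → ℕ := fun j => C j / p.cellsPerChunkDim

/-- Neighboring cells (a cell is a neighbor of itself): with `reach = 1` these are the `3^d`
cells that touch a given one, clipped to the unit cube. -/
def Neighbor (C C' : Fin p.d → ℕ) : Prop := ∀ j, C j ≤ C' j + p.reach ∧ C' j ≤ C j + p.reach

/-- The chunk at position `z` of the Z-order curve: the binary digits of its coordinates
are interleaved in `z`. -/
def zOrder (z : ℕ) : Fin p.d → ℕ := fun j =>
  ∑ l ∈ Finset.range p.depth, if z.testBit (p.d * l + j) then 2 ^ l else 0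

/-- The chunks of PE `i`: the Z-order curve is cut into `P` consecutive pieces, each of `⌊k/P⌋` or
`⌈k/P⌉` chunks. -/
def localChunks (i : Fin p.P) : Finset (Fin p.d → ℕ) :=
  ((Finset.range p.numChunks).filter fun z => z * p.P / p.numChunks = i).image p.zOrder

/-- The cells in the chunks of PE `i`. -/
def localCells (i : Fin p.P) : Finset (Fin p.d → ℕ) :=
  p.cells.filter fun C => p.chunkOf C ∈ p.localChunks i

open Classical in
/-- The cells whose vertices PE `i` generates: its own cells and their neighbors. -/
def generatedCells (i : Fin p.P) : Finset (Fin p.d → ℕ) :=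
  p.cells.filter fun C' => ∃ C ∈ p.localCells i, p.Neighbor C C'

/-- The chunks which PE `i` reaches in the recursion: those that contain a generated cell. -/
def generatedChunks (i : Fin p.P) : Finset (Fin p.d → ℕ) := (p.generatedCells i).image p.chunkOf

/-- Binomial variates drawn in the recursion: for each generated chunk, `2^d - 1` on each of the
`b` levels. -/
def recursionVariates (i : Fin p.P) : ℕ :=
  (p.generatedChunks i).card * (p.depth * (2 ^ p.d - 1))

/-- Binomial variates drawn inside the generated chunks: one for each cell. -/
def cellVariates (i : Fin p.P) : ℕ :=
  (p.generatedChunks i).card * p.cellsPerChunkDim ^ p.d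

open Classical in
/-- Pairs of a local cell and a neighboring cell over which PE `i` iterates. -/
def cellVisits (i : Fin p.P) : ℕ :=
  ((p.localCells i ×ˢ p.cells).filter fun q => p.Neighbor q.1 q.2).card

/-- Vertices (local or redundant) whose position PE `i` generates. -/
def vertexSamples (i : Fin p.P) (X : Fin p.n → Fin p.d → ℝ) : ℕ :=
  (Finset.univ.filter fun u => p.cellOf (X u) ∈ p.generatedCells i).card

open Classical in
/-- Distance computations of PE `i`: each unordered pair of distinct vertices in neighboring (or
equal) cells, at least one of which is local, is compared exactly once. (Pairs of two local cells
are processed only from the cell with the lower id.) -/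
def distanceComputations (i : Fin p.P) (X : Fin p.n → Fin p.d → ℝ) : ℕ :=
  (Finset.univ.filter fun q : Fin p.n × Fin p.n =>
    q.1 < q.2 ∧ p.Neighbor (p.cellOf (X q.1)) (p.cellOf (X q.2)) ∧
      (p.cellOf (X q.1) ∈ p.localCells i ∨ p.cellOf (X q.2) ∈ p.localCells i)).card

/-- The work of PE `i` when the generated points are `X`, in the unit-cost model in which drawing
a binomial variate, generating a vertex, visiting a pair of cells, and comparing a pair of vertices
(with the output of the edge, if there is one) cost one step each. -/
def work (i : Fin p.P) (X : Fin p.n → Fin p.d → ℝ) : ℕ :=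
  p.recursionVariates i + p.cellVariates i + p.cellVisits i + p.vertexSamples i X +
    p.distanceComputations i X

end Params

end RGG

end

/-! Everything is compared with `size` = n² min(r,1)^d + n. Cut the cube into cells of diameter at
most r: two points in the same cell are adjacent, so Cauchy–Schwarz for the cell occupancies shows
that m + n is at least a constant times `size` for every configuration in the cube
(`sq_mul_le_numEdges`). Integration gives the same for E[m] + n. Hence one estimate, work =
O(`size`/P) for all PEs with high probability, yields both bounds, and no concentration of m is
needed.

The part of the work that does not depend on the points is bounded by counting: k ≤ 2^d P, a PE owns
at most 2^d chunks, and n dominates both P² b and k P. The part that depends on them is governed by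
the occupancies N_C of the cells, with mean at most μ = n/G^d, where G is the number of cells per
dimension.

If r ≤ 2^(-b), a PE generates at most 6^d g^d cells, and since a cell has boundedly many neighbors,
its work is O(∑ N_C²) over them. This sum is controlled by an exponential moment, in which the
points are integrated out one at a time (`lintegral_exp_truncPairs_le`). The contribution of a new
point is truncated at β, so that the exponents stay at most 1; with high probability no occupancy
exceeds β, and the truncation changes nothing. The required exponent of order log n is available
because log² n = O(√n) = O(n/k).

If r > 2^(-b), every chunk is a single cell and μ = n/k is at least of order √n, so all occupancies
are O(μ) simultaneously. The number of visited cell pairs times the square of this maximum is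
already small enough. -/

namespace RGG

/-! ### Exponential moments of occupancy numbers -/

section Occupancy

variable {α : Type*} [DecidableEq α]

/-- The number of indices that `X` maps to `c`. -/
def occ {n : ℕ} (X : Fin n → α) (c : α) : ℕ := (Finset.univ.filter fun u => X u = c).card

/-- The number of pairs of indices with the same value in `S`, where every index is counted
with at most `β` of its successors. -/
noncomputable def truncPairs (S : Finset α) (β : ℝ) : {n : ℕ} → (Fin n → α) → ℝ
  | 0, _ => 0
  | _ + 1, X => truncPairs S β (Fin.tail X) +
      if X 0 ∈ S then min β (occ (Fin.tail X) (X 0)) else 0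

lemma occ_succ {n : ℕ} (X : Fin (n + 1) → α) (c : α) :
    occ X c = occ (Fin.tail X) c + if X 0 = c then 1 else 0 := by
  rw [occ, occ, Finset.card_filter, Finset.card_filter, Fin.sum_univ_succ, Nat.add_comm]
  rfl

/-- Raising an occupancy from N to N + 1 raises its square by 2N + 1, and the first index
contributes exactly N to `truncPairs` as long as the cap β is not active. Summed over all indices
this is N² = 2 (N choose 2) + N. -/
lemma sum_sq_occ_eq (S : Finset α) (β : ℝ) {n : ℕ} (X : Fin n → α)
    (hX : ∀ c ∈ S, (occ X c : ℝ) ≤ β) :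
    ∑ c ∈ S, (occ X c : ℝ) ^ 2 = 2 * truncPairs S β X + ∑ c ∈ S, (occ X c : ℝ) := by
  induction n with
  | zero => simp [truncPairs, occ]
  | succ n ih =>
    have h1 : ∀ c ∈ S, (occ (Fin.tail X) c : ℝ) ≤ β := fun c hc => by
      refine le_trans ?_ (hX c hc)
      rw [occ_succ]; push_cast; split_ifs <;> simp
    have h2 : ∑ c ∈ S, (occ X c : ℝ) ^ 2 = ∑ c ∈ S, (occ (Fin.tail X) c : ℝ) ^ 2 +
        ∑ c ∈ S, if X 0 = c then 2 * (occ (Fin.tail X) c : ℝ) + 1 else 0 := by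
      rw [← Finset.sum_add_distrib]
      refine Finset.sum_congr rfl fun c _ => ?_
      rw [occ_succ]; split_ifs <;> push_cast <;> ring
    have h3 : ∑ c ∈ S, (occ X c : ℝ) = ∑ c ∈ S, (occ (Fin.tail X) c : ℝ) +
        ∑ c ∈ S, if X 0 = c then (1 : ℝ) else 0 := by
      rw [← Finset.sum_add_distrib]
      refine Finset.sum_congr rfl fun c _ => ?_
      rw [occ_succ]; push_cast; rfl
    rw [h2, h3, ih _ h1, truncPairs, Finset.sum_ite_eq, Finset.sum_ite_eq]
    by_cases h : X 0 ∈ S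
    · simp only [h, if_true]; rw [min_eq_right (h1 _ h)]; ring
    · simp only [h, if_false]; ring

lemma exp_sub_one_le_two_mul {x : ℝ} (h0 : 0 ≤ x) (h1 : x ≤ 1) : Real.exp x ≤ 1 + 2 * x := by
  have h := Real.abs_exp_sub_one_sub_id_le (x := x) (by rw [abs_of_nonneg h0]; exact h1)
  have := (abs_le.1 h).2
  nlinarith

variable [Countable α] [MeasurableSpace α] [DiscreteMeasurableSpace α]

/-- The exponential moment of a single point: e^x ≤ 1 + 2x on [0,1] linearizes the integrand, and 1
+ y ≤ e^y turns the mean back into an exponential. Only upper bounds on the point masses enter. -/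
lemma lintegral_exp_indicator_le (ν : Measure α) [IsProbabilityMeasure ν] (S : Finset α) {p : ℝ}
    (hp : 0 ≤ p) (hS : ∀ c ∈ S, ν {c} ≤ ENNReal.ofReal p) (h : α → ℝ)
    (h0 : ∀ c ∈ S, 0 ≤ h c) (h1 : ∀ c ∈ S, h c ≤ 1) :
    ∫⁻ x, ENNReal.ofReal (Real.exp (if x ∈ S then h x else 0)) ∂ν ≤
      ENNReal.ofReal (Real.exp (2 * p * ∑ c ∈ S, h c)) := by
  have key : ∀ x, ENNReal.ofReal (Real.exp (if x ∈ S then h x else 0)) ≤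
      1 + ∑ c ∈ S, ({c} : Set α).indicator (fun _ => ENNReal.ofReal (2 * h c)) x := by
    intro x
    by_cases hx : x ∈ S
    · rw [if_pos hx]
      refine (ENNReal.ofReal_le_ofReal (exp_sub_one_le_two_mul (h0 x hx) (h1 x hx))).trans ?_
      rw [ENNReal.ofReal_add one_pos.le (by have := h0 x hx; positivity), ENNReal.ofReal_one]
      gcongr
      refine le_trans ?_ (Finset.single_le_sum
        (f := fun c => ({c} : Set α).indicator (fun _ => ENNReal.ofReal (2 * h c)) x)
        (fun _ _ => zero_le) hx)
      simp
    · simp [hx]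
  refine (lintegral_mono key).trans ?_
  rw [lintegral_add_left measurable_const, lintegral_finsetSum' _ (fun c _ => by fun_prop)]
  simp only [lintegral_const, measure_univ, mul_one]
  have : ∀ c ∈ S, ∫⁻ x, ({c} : Set α).indicator (fun _ => ENNReal.ofReal (2 * h c)) x ∂ν ≤
      ENNReal.ofReal (2 * p * h c) := fun c hc => by
    rw [lintegral_indicator_const (measurableSet_singleton c)]
    refine (mul_le_mul_right (hS c hc) _).trans ?_
    rw [← ENNReal.ofReal_mul (by have := h0 c hc; positivity)]
    exact ENNReal.ofReal_le_ofReal (le_of_eq (by ring))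
  refine (add_le_add_right (Finset.sum_le_sum this) 1).trans ?_
  rw [← ENNReal.ofReal_sum_of_nonneg (fun c hc => by have := h0 c hc; positivity),
    ← ENNReal.ofReal_one, ← ENNReal.ofReal_add one_pos.le
    (Finset.sum_nonneg fun c hc => by have := h0 c hc; positivity)]
  refine ENNReal.ofReal_le_ofReal ?_
  rw [← Finset.mul_sum, add_comm]
  exact Real.add_one_le_exp _

/-- Integrate out the first point with the others fixed. Its factor has mean at most exp(2p(a ∑ N_c
+ |S| θ)), so the linear weight θ of the remaining points grows by 2pa. After n points it has grown
by 2pan, and the hypothesis says that even then the exponent aβ + θ of one point is at most 1. This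
is why θ is quantified inside the induction. -/
lemma lintegral_exp_truncPairs_le (ν : Measure α) [IsProbabilityMeasure ν] (S : Finset α)
    {p a β : ℝ} (hp : 0 ≤ p) (hS : ∀ c ∈ S, ν {c} ≤ ENNReal.ofReal p) (ha : 0 ≤ a) (hβ : 0 ≤ β)
    (n : ℕ) : ∀ θ : ℝ, 0 ≤ θ → a * β + θ + 2 * p * a * n ≤ 1 →
    ∫⁻ X : Fin n → α, ENNReal.ofReal
        (Real.exp (a * truncPairs S β X + θ * ∑ c ∈ S, (occ X c : ℝ)))
        ∂(Measure.pi fun _ => ν) ≤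
      ENNReal.ofReal (Real.exp (2 * p * S.card * (n * θ + p * a * n ^ 2))) := by
  induction n with
  | zero => intro θ _ _; simp [truncPairs, occ]
  | succ n ih =>
    intro θ hθ hc
    push_cast at hc
    have hpan : 0 ≤ 2 * p * a * n := by positivity
    have hpa : 0 ≤ 2 * p * a := by positivity
    let F : α × (Fin n → α) → ENNReal := fun q =>
      ENNReal.ofReal (Real.exp (if q.1 ∈ S then a * min β (occ q.2 q.1) + θ else 0)) *
      ENNReal.ofReal (Real.exp (a * truncPairs S β q.2 + θ * ∑ c ∈ S, (occ q.2 c : ℝ)))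
    have hF : ∀ X : Fin (n + 1) → α, ENNReal.ofReal
        (Real.exp (a * truncPairs S β X + θ * ∑ c ∈ S, (occ X c : ℝ))) =
        F (MeasurableEquiv.piFinSuccAbove (fun _ => α) 0 X) := by
      intro X
      have e : MeasurableEquiv.piFinSuccAbove (fun _ => α) 0 X = (X 0, Fin.tail X) := by
        rfl
      rw [e]
      simp only [F]
      rw [← ENNReal.ofReal_mul (Real.exp_nonneg _), ← Real.exp_add]
      congr 2
      simp only [occ_succ X, truncPairs]
      push_cast
      rw [Finset.sum_add_distrib, Finset.sum_ite_eq]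
      split_ifs <;> ring
    simp_rw [hF]
    rw [(measurePreserving_piFinSuccAbove (fun _ => ν) 0).lintegral_comp (Measurable.of_discrete),
      lintegral_prod_symm' _ (Measurable.of_discrete)]
    have step : ∀ X : Fin n → α, ∫⁻ x, F (x, X) ∂ν ≤
        ENNReal.ofReal (Real.exp (2 * p * S.card * θ)) * ENNReal.ofReal (Real.exp
          (a * truncPairs S β X + (θ + 2 * p * a) * ∑ c ∈ S, (occ X c : ℝ))) := by
      intro X
      simp only [F]
      rw [lintegral_mul_const _ (Measurable.of_discrete)]
      have h := lintegral_exp_indicator_le ν S hp hS (fun c => a * min β (occ X c) + θ)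
        (fun c _ => by positivity) (fun c _ => by
          have := mul_le_mul_of_nonneg_left (min_le_left β (occ X c : ℝ)) ha
          linarith)
      refine (mul_le_mul_left h _).trans ?_
      rw [← ENNReal.ofReal_mul (Real.exp_nonneg _), ← ENNReal.ofReal_mul (Real.exp_nonneg _),
        ← Real.exp_add, ← Real.exp_add]
      refine ENNReal.ofReal_le_ofReal (Real.exp_le_exp.2 ?_)
      have h2 : ∑ c ∈ S, (a * min β (occ X c : ℝ) + θ) ≤
          a * ∑ c ∈ S, (occ X c : ℝ) + S.card * θ := by
        rw [Finset.mul_sum, Finset.sum_add_distrib, Finset.sum_const, nsmul_eq_mul]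
        gcongr
        exact min_le_right _ _
      have h3 := mul_le_mul_of_nonneg_left h2 (by positivity : 0 ≤ 2 * p)
      linarith
    refine (lintegral_mono step).trans ?_
    rw [lintegral_const_mul _ (Measurable.of_discrete)]
    refine (mul_le_mul_right (ih (θ + 2 * p * a) (by positivity) (by linarith)) _).trans ?_
    rw [← ENNReal.ofReal_mul (Real.exp_nonneg _), ← Real.exp_add]
    refine ENNReal.ofReal_le_ofReal (Real.exp_le_exp.2 ?_)
    -- The exponents satisfy θ + n(θ + 2pa) + pa n² = (n+1)θ + pa((n+1)² - 1); this nonnegative term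
    -- is the slack.
    have : 0 ≤ 2 * p * S.card * (p * a) := by positivity
    push_cast
    nlinarith

/-- The exponential Markov inequality. -/
lemma measure_gt_le_exp {Ω : Type*} [MeasurableSpace Ω] (μ : Measure Ω) {f : Ω → ℝ}
    (hf : Measurable f) {B t : ℝ}
    (h : ∫⁻ x, ENNReal.ofReal (Real.exp (f x)) ∂μ ≤ ENNReal.ofReal (Real.exp B)) :
    μ {x | t < f x} ≤ ENNReal.ofReal (Real.exp (B - t)) := by
  have h1 := meas_ge_le_lintegral_div (μ := μ) (f := fun x => ENNReal.ofReal (Real.exp (f x)))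
    (by fun_prop) (ε := ENNReal.ofReal (Real.exp t)) (by simp [Real.exp_pos]) (by simp)
  refine (measure_mono fun x hx => ?_).trans (h1.trans ?_)
  · exact ENNReal.ofReal_le_ofReal (Real.exp_le_exp.2 (le_of_lt hx))
  · rw [Real.exp_sub, ENNReal.ofReal_div_of_pos (Real.exp_pos _)]
    gcongr

lemma measure_occ_gt_le (ν : Measure α) [IsProbabilityMeasure ν] {c : α} {p : ℝ}
    (hp : 0 ≤ p) (hc : ν {c} ≤ ENNReal.ofReal p) (n : ℕ) (β : ℝ) :
    (Measure.pi fun _ : Fin n => ν) {X | β < (occ X c : ℝ)} ≤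
      ENNReal.ofReal (Real.exp (2 * (n * p) - β)) := by
  have h := lintegral_exp_truncPairs_le ν {c} (a := 0) (β := 0) hp (by simpa using hc) le_rfl
    le_rfl n 1 one_pos.le (by simp)
  simp only [zero_mul, zero_add, one_mul, Finset.sum_singleton, mul_one, mul_zero,
    Finset.card_singleton, Nat.cast_one, add_zero] at h
  refine (measure_gt_le_exp _ Measurable.of_discrete h).trans (le_of_eq ?_)
  congr 2; ring

/-- The event includes the cap on the occupancies, so on it the truncated sum equals the true sum of
squares. The threshold is twice the bound for the logarithmic moment divided by the weight `l`,
which leaves half of it as the tail exponent. -/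
lemma measure_sum_sq_occ_gt_le (ν : Measure α) [IsProbabilityMeasure ν] (S : Finset α)
    {p β σ : ℝ} (hp : 0 ≤ p) (hS : ∀ c ∈ S, ν {c} ≤ ENNReal.ofReal p) (hβ : 0 ≤ β)
    (hσ : (S.card : ℝ) ≤ σ) (n : ℕ) {μ : ℝ} (hμ : μ = n * p) :
    (Measure.pi fun _ : Fin n => ν) {X | (∀ c ∈ S, (occ X c : ℝ) ≤ β) ∧
        4 * σ * (μ + 2 * μ ^ 2) < ∑ c ∈ S, (occ X c : ℝ) ^ 2} ≤
      ENNReal.ofReal (Real.exp (-(2 * σ * (μ + 2 * μ ^ 2) / (2 * β + 1 + 4 * μ)))) := by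
  have hμ0 : 0 ≤ μ := hμ ▸ by positivity
  -- With weights 2l for pairs and l for points the exponent is l ∑ N_c², and this l makes the
  -- condition of the moment bound an equality.
  set l : ℝ := 1 / (2 * β + 1 + 4 * μ) with hl
  have hl0 : 0 < l := by positivity
  have hl1 : l * (2 * β + 1 + 4 * μ) = 1 := by rw [hl]; field_simp
  have h := lintegral_exp_truncPairs_le ν S (a := 2 * l) (β := β) hp hS (by positivity)
    hβ n l hl0.le (by rw [← hl1, hμ]; apply le_of_eq; ring)
  have hB : 2 * p * S.card * (n * l + p * (2 * l) * n ^ 2) ≤ 2 * l * σ * (μ + 2 * μ ^ 2) := by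
    have e : 2 * p * S.card * (n * l + p * (2 * l) * n ^ 2) =
        2 * l * S.card * (μ + 2 * μ ^ 2) := by rw [hμ]; ring
    rw [e]; gcongr
  replace h := h.trans (ENNReal.ofReal_le_ofReal (Real.exp_le_exp.2 hB))
  have h2 := measure_gt_le_exp (t := l * (4 * σ * (μ + 2 * μ ^ 2))) _ Measurable.of_discrete h
  refine (measure_mono fun X hX => ?_).trans (h2.trans (le_of_eq ?_))
  · have h3 := hX.2
    rw [sum_sq_occ_eq S β X hX.1] at h3
    have := mul_lt_mul_of_pos_left h3 hl0
    simp only [Set.mem_ofPred_eq]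
    linarith
  · congr 2; rw [hl]; ring

end Occupancy

/-- The unit cube `[0,1)^d` as a set of configurations. -/
def InCube {n d : ℕ} (X : Fin n → Fin d → ℝ) : Prop := ∀ u j, X u j ∈ Set.Ico (0 : ℝ) 1

/-! ### Deterministic lower bound for the number of edges -/

lemma sum_occ_eq_card {α : Type*} [DecidableEq α] (S : Finset α) {n : ℕ} (X : Fin n → α) :
    ∑ c ∈ S, occ X c = (Finset.univ.filter fun u => X u ∈ S).card := by
  rw [Finset.card_eq_sum_card_fiberwise (f := X) (t := S)
    (fun u hu => by simpa using hu)]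
  refine Finset.sum_congr rfl fun c hc => ?_
  rw [occ, Finset.filter_filter]
  congr 1
  ext u
  simp only [Finset.mem_filter, Finset.mem_univ, true_and]
  exact ⟨fun h => ⟨h ▸ hc, h⟩, fun h => h.2⟩

/-- The number of ordered pairs of indices with equal values in `S`. -/
lemma sum_sq_occ_eq_card {α : Type*} [DecidableEq α] (S : Finset α) {n : ℕ} (X : Fin n → α) :
    ∑ c ∈ S, occ X c ^ 2 =
      (Finset.univ.filter fun q : Fin n × Fin n => X q.1 ∈ S ∧ X q.2 = X q.1).card := by
  rw [Finset.card_eq_sum_card_fiberwise (f := fun q => X q.1) (t := S)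
    (fun u hu => by simp at hu; simpa using hu.1)]
  refine Finset.sum_congr rfl fun c hc => ?_
  rw [occ, sq, ← Finset.card_product, Finset.filter_filter]
  congr 1
  ext ⟨u, v⟩
  simp only [Finset.mem_filter, Finset.mem_univ, true_and, Finset.mem_product]
  exact ⟨fun h => ⟨⟨h.1 ▸ hc, h.2.trans h.1.symm⟩, h.1⟩, fun h => ⟨h.2, h.1.2.trans h.2⟩⟩

open Classical in
lemma two_mul_numEdges_eq {n d : ℕ} (r : ℝ) (X : Fin n → Fin d → ℝ) :
    2 * numEdges r X =
      (Finset.univ.filter fun q : Fin n × Fin n => (geomGraph r X).Adj q.1 q.2).card := by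
  have h := (geomGraph r X).sum_degrees_eq_twice_card_edges
  rw [numEdges, ← SimpleGraph.coe_edgeFinset, Set.ncard_coe_finset, ← h,
    Finset.card_filter, Fintype.sum_prod_type]
  refine Finset.sum_congr rfl fun u _ => ?_
  rw [← SimpleGraph.card_neighborFinset_eq_degree, ← Finset.card_filter]
  congr 1
  ext v; simp

lemma floor_mul_mem_range {x : ℝ} (hx : x ∈ Set.Ico (0 : ℝ) 1) {M : ℕ} (hM : 0 < M) :
    ⌊x * M⌋₊ ∈ Finset.range M := by
  have hM' : (0 : ℝ) < M := by exact_mod_cast hM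
  rw [Finset.mem_range, Nat.floor_lt (mul_nonneg hx.1 hM'.le)]
  nlinarith [hx.2]

lemma abs_sub_le_of_floor_eq {x y : ℝ} (hx : 0 ≤ x) (hy : 0 ≤ y) {M : ℕ} (hM : 0 < M)
    (h : ⌊x * M⌋₊ = ⌊y * M⌋₊) : |x - y| ≤ 1 / M := by
  have hM' : (0 : ℝ) < M := by exact_mod_cast hM
  have h1 := Nat.floor_le (mul_nonneg hx hM'.le)
  have h2 := Nat.floor_le (mul_nonneg hy hM'.le)
  have h3 := Nat.lt_floor_add_one (x * (M : ℝ))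
  have h4 := Nat.lt_floor_add_one (y * (M : ℝ))
  rw [h] at h1 h3
  rw [abs_le, ← neg_div, div_le_iff₀ hM', le_div_iff₀ hM']
  constructor <;> nlinarith

lemma eucl_le_of_abs_sub_le {d : ℕ} {x y : Fin d → ℝ} {t : ℝ} (ht : 0 ≤ t)
    (h : ∀ j, |x j - y j| ≤ t) : eucl x y ≤ √d * t := by
  rw [eucl, ← Real.sqrt_sq ht, ← Real.sqrt_mul (by positivity)]
  refine Real.sqrt_le_sqrt ?_
  calc ∑ j, (x j - y j) ^ 2 ≤ ∑ _j : Fin d, t ^ 2 :=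
        Finset.sum_le_sum fun j _ => sq_le_sq' (by linarith [(abs_le.1 (h j)).1])
          (abs_le.1 (h j)).2
    _ = d * t ^ 2 := by simp

/-- By the Cauchy–Schwarz inequality for the occupancies of a grid whose cells have diameter at
most `r`, there are always many edges. -/
lemma sq_mul_le_numEdges {n d : ℕ} {r : ℝ} (hr : 0 < r) {X : Fin n → Fin d → ℝ}
    (hX : InCube X) :
    (n : ℝ) ^ 2 * (min r 1) ^ d ≤ (√d + 1) ^ d * (2 * numEdges r X + n) := by
  classical
  -- Fine enough for cells of side 1/M to have diameter at most r, but no finer than needed: M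
  -- min(r,1) ≤ √d + 1.
  set M : ℕ := max 1 ⌈√d / r⌉₊ with hMdef
  have hM : 0 < M := lt_of_lt_of_le one_pos (le_max_left _ _)
  have hM' : (0 : ℝ) < M := by exact_mod_cast hM
  set ρ := min r 1 with hρ
  have hρ0 : 0 < ρ := lt_min hr one_pos
  have hMr : √d / M ≤ r := by
    rw [div_le_iff₀ hM', mul_comm, ← div_le_iff₀ hr]
    exact (Nat.le_ceil _).trans (by exact_mod_cast le_max_right _ _)
  have hMρ : M * ρ ≤ √d + 1 := by
    have h1 : (M : ℝ) ≤ √d / r + 1 := by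
      rw [hMdef]; push_cast
      refine max_le (by simp; positivity) (Nat.ceil_lt_add_one (by positivity)).le
    calc (M : ℝ) * ρ ≤ (√d / r + 1) * ρ := by gcongr
      _ = √d / r * ρ + ρ := by ring
      _ ≤ √d / r * r + 1 := by gcongr; exacts [min_le_left _ _, min_le_right _ _]
      _ = √d + 1 := by field_simp
  let Y : Fin n → Fin d → ℕ := fun u j => ⌊X u j * M⌋₊
  let T : Finset (Fin d → ℕ) := Fintype.piFinset fun _ => Finset.range M
  have hT : T.card = M ^ d := by simp [T]
  have hY : ∀ u, Y u ∈ T := fun u =>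
    Fintype.mem_piFinset.2 fun j => floor_mul_mem_range (hX u j) hM
  have hsum : ∑ c ∈ T, occ Y c = n := by
    rw [sum_occ_eq_card, Finset.filter_true_of_mem fun u _ => hY u]; simp
  have hcs : (n : ℝ) ^ 2 ≤ M ^ d * ∑ c ∈ T, (occ Y c : ℝ) ^ 2 := by
    have h := sq_sum_le_card_mul_sum_sq (s := T) (f := fun c => (occ Y c : ℝ))
    rw [hT, ← Nat.cast_sum, hsum] at h
    exact_mod_cast h
  -- Ordered pairs in a common grid cell are either edges, each counted twice, or one of the n
  -- diagonal pairs.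
  have hE : ∑ c ∈ T, occ Y c ^ 2 ≤ 2 * numEdges r X + n := by
    rw [sum_sq_occ_eq_card, two_mul_numEdges_eq]
    calc _ ≤ ((Finset.univ.filter fun q : Fin n × Fin n => (geomGraph r X).Adj q.1 q.2) ∪
          (Finset.univ.image fun u : Fin n => (u, u))).card := by
          refine Finset.card_le_card fun q hq => ?_
          simp only [Finset.mem_filter, Finset.mem_univ, true_and] at hq
          simp only [Finset.mem_union, Finset.mem_filter, Finset.mem_univ, true_and,
            Finset.mem_image]
          by_cases h : q.1 = q.2
          · exact Or.inr ⟨q.1, Prod.ext rfl h⟩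
          · refine Or.inl ⟨h, le_trans (eucl_le_of_abs_sub_le (t := 1 / M) (by positivity)
              fun j => ?_) (by rw [mul_one_div]; exact hMr)⟩
            exact abs_sub_le_of_floor_eq (hX _ j).1 (hX _ j).1 hM (congrFun hq.2.symm j)
      _ ≤ _ := (Finset.card_union_le _ _).trans
          (by gcongr; exact Finset.card_image_le.trans (by simp))
  have hE' : ∑ c ∈ T, (occ Y c : ℝ) ^ 2 ≤ 2 * numEdges r X + n := by exact_mod_cast hE
  calc (n : ℝ) ^ 2 * ρ ^ d ≤ M ^ d * (2 * numEdges r X + n) * ρ ^ d := by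
        gcongr; exact hcs.trans (by gcongr)
    _ = (M * ρ) ^ d * (2 * numEdges r X + n) := by rw [mul_pow]; ring
    _ ≤ _ := by gcongr

/-- A lower bound for `m + n`, valid for all configurations in the cube. -/
lemma le_numEdges_add {n d : ℕ} {r : ℝ} (hr : 0 < r) {X : Fin n → Fin d → ℝ}
    (hX : InCube X) :
    (n : ℝ) ^ 2 * (min r 1) ^ d + n ≤ 3 * (√d + 1) ^ d * (numEdges r X + n) := by
  have h := sq_mul_le_numEdges hr hX
  have h1 : 1 ≤ (√d + 1) ^ d := one_le_pow₀ (by simp)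
  have h2 : (0 : ℝ) ≤ numEdges r X := by positivity
  have h3 : (0 : ℝ) ≤ n := by positivity
  have h4 := mul_nonneg h3 (sub_nonneg.2 h1)
  have h5 := mul_nonneg h2 (by linarith : 0 ≤ (√d + 1) ^ d)
  nlinarith

instance (n d : ℕ) : IsProbabilityMeasure (uniformPoints n d) := by
  have : IsProbabilityMeasure (volume.restrict (Set.Ico (0 : ℝ) 1)) := ⟨by simp⟩
  unfold uniformPoints; infer_instance

lemma ae_inCube (n d : ℕ) : ∀ᵐ X ∂(uniformPoints n d), InCube X := by
  have h0 : IsProbabilityMeasure (volume.restrict (Set.Ico (0 : ℝ) 1)) := ⟨by simp⟩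
  have h1 : ∀ᵐ x ∂(volume.restrict (Set.Ico (0 : ℝ) 1)), x ∈ Set.Ico (0 : ℝ) 1 :=
    ae_restrict_mem measurableSet_Ico
  refine ae_all_iff.2 fun u => ae_all_iff.2 fun j => ?_
  have h2 := (measurePreserving_eval (fun _ : Fin n => Measure.pi fun _ : Fin d =>
    volume.restrict (Set.Ico (0 : ℝ) 1)) u)
  have h3 := (measurePreserving_eval (fun _ : Fin d => volume.restrict (Set.Ico (0 : ℝ) 1)) j)
  exact (h3.comp h2).quasiMeasurePreserving.ae h1

lemma measurable_numEdges (n d : ℕ) (r : ℝ) :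
    Measurable fun X : Fin n → Fin d → ℝ => numEdges r X := by
  classical
  have h : (fun X : Fin n → Fin d → ℝ => numEdges r X) = fun X =>
      (∑ q : Fin n × Fin n, if (geomGraph r X).Adj q.1 q.2 then 1 else 0) / 2 := by
    funext X
    rw [← Finset.card_filter]
    have := two_mul_numEdges_eq r X
    omega
  rw [h]
  refine (Measurable.of_discrete (f := fun m : ℕ => m / 2)).comp
    (Finset.measurable_fun_sum _ fun q _ => Measurable.ite ?_ measurable_const measurable_const)
  simp only [geomGraph, Set.ofPred_and]
  refine (MeasurableSet.const _).inter (measurableSet_le ?_ measurable_const)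
  unfold eucl
  fun_prop

lemma numEdges_le {n d : ℕ} (r : ℝ) (X : Fin n → Fin d → ℝ) : numEdges r X ≤ n * n := by
  classical
  have h := two_mul_numEdges_eq r X
  have : (Finset.univ.filter fun q : Fin n × Fin n => (geomGraph r X).Adj q.1 q.2).card ≤ n * n :=
    (Finset.card_filter_le _ _).trans (by simp)
  omega

lemma integrable_numEdges (n d : ℕ) (r : ℝ) :
    Integrable (fun X => (numEdges r X : ℝ)) (uniformPoints n d) := by
  refine Integrable.of_bound
    ((measurable_from_nat (f := fun m : ℕ => (m : ℝ))).comp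
      (measurable_numEdges n d r)).aestronglyMeasurable ((n * n : ℕ) : ℝ) (ae_of_all _ fun X => ?_)
  simp only [Real.norm_natCast]
  exact_mod_cast numEdges_le r X

/-- The pointwise bound holds almost surely, so it survives integration; the edge probability never
has to be computed. -/
lemma le_expEdges_add {n d : ℕ} {r : ℝ} (hr : 0 < r) :
    (n : ℝ) ^ 2 * (min r 1) ^ d + n ≤ 3 * (√d + 1) ^ d * (expEdges n d r + n) := by
  have hpos : 0 < 3 * (√d + 1) ^ d := by positivity
  have h : ∀ᵐ X ∂(uniformPoints n d),
      ((n : ℝ) ^ 2 * (min r 1) ^ d + n) / (3 * (√d + 1) ^ d) - n ≤ numEdges r X := by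
    filter_upwards [ae_inCube n d] with X hX
    rw [sub_le_iff_le_add, div_le_iff₀ hpos]
    linarith [le_numEdges_add hr hX]
  have h2 := integral_mono_ae (integrable_const _) (integrable_numEdges n d r) h
  rw [integral_const, probReal_univ, one_smul, sub_le_iff_le_add, div_le_iff₀ hpos] at h2
  rw [expEdges]
  linarith

lemma sum_occ_mul_occ_eq_card {α : Type*} [DecidableEq α] (V : Finset (α × α)) {n : ℕ}
    (X : Fin n → α) :
    ∑ c ∈ V, occ X c.1 * occ X c.2 =
      (Finset.univ.filter fun q : Fin n × Fin n => (X q.1, X q.2) ∈ V).card := by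
  rw [Finset.card_eq_sum_card_fiberwise (f := fun q => (X q.1, X q.2)) (t := V)
    (fun u hu => by simpa using hu)]
  refine Finset.sum_congr rfl fun c hc => ?_
  rw [occ, occ, ← Finset.card_product, Finset.filter_filter]
  congr 1
  ext ⟨u, v⟩
  simp only [Finset.mem_filter, Finset.mem_univ, true_and, Finset.mem_product]
  exact ⟨fun h => ⟨by rw [h.1, h.2]; exact hc, Prod.ext h.1 h.2⟩,
    fun h => ⟨congrArg Prod.fst h.2, congrArg Prod.snd h.2⟩⟩

/-! ### Counting chunks, cells and neighbors -/

namespace Params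

variable (p : Params)

lemma one_le_cellsPerChunkDim : 1 ≤ p.cellsPerChunkDim := le_max_left _ _

lemma cellsPerDim_pos : 0 < p.cellsPerDim :=
  Nat.mul_pos (by positivity) p.one_le_cellsPerChunkDim

lemma numChunks_eq : p.numChunks = (2 ^ p.d) ^ p.depth := by rw [numChunks, pow_mul]

lemma cellsPerDim_pow : p.cellsPerDim ^ p.d = p.numChunks * p.cellsPerChunkDim ^ p.d := by
  rw [cellsPerDim, mul_pow, numChunks, mul_comm p.d, pow_mul]

lemma numChunks_pos : 0 < p.numChunks := by rw [numChunks]; positivity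

lemma le_numChunks (hd : 1 ≤ p.d) : p.P ≤ p.numChunks := by
  rw [numChunks_eq]
  exact Nat.le_pow_clog (Nat.one_lt_two_pow (by omega)) _

lemma depth_eq_zero (hP : p.P = 1) : p.depth = 0 := by
  rw [depth, hP, Nat.clog_one_right]

lemma numChunks_eq_one (hP : p.P = 1) : p.numChunks = 1 := by
  rw [numChunks, p.depth_eq_zero hP]; simp

/-- By minimality of the depth, one level less gives fewer than P chunks. For P = 1 there is no such
level, and k = 1. -/
lemma numChunks_le (hd : 1 ≤ p.d) (hP : 1 ≤ p.P) : p.numChunks ≤ 2 ^ p.d * p.P := by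
  rcases hP.eq_or_lt with h | h
  · rw [p.numChunks_eq_one h.symm, ← h]; exact Nat.mul_pos (by positivity) one_pos
  · have h1 : 1 < 2 ^ p.d := Nat.one_lt_two_pow (by omega)
    have h2 := Nat.pow_pred_clog_lt_self h1 h
    have h3 : 0 < p.depth := Nat.clog_pos h1 h
    rw [numChunks_eq, ← Nat.succ_pred_eq_of_pos h3, pow_succ, mul_comm]
    exact Nat.mul_le_mul_left _ h2.le

/-- The positions z of PE i satisfy i k ≤ z P < (i+1) k, so they lie in a window of length at most
k/P ≤ 2^d. Injectivity of the Z-order map is not needed for an upper bound. -/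
lemma card_localChunks_le (hd : 1 ≤ p.d) (i : Fin p.P) : (p.localChunks i).card ≤ 2 ^ p.d := by
  have hP : 1 ≤ p.P := Nat.one_le_of_lt i.2
  refine Finset.card_image_le.trans ?_
  set s := (Finset.range p.numChunks).filter fun z => z * p.P / p.numChunks = i with hs
  rcases s.eq_empty_or_nonempty with h | h
  · rw [h]; simp
  · have hmem : ∀ z ∈ s, i * p.numChunks ≤ z * p.P ∧ z * p.P < (i + 1) * p.numChunks := by
      intro z hz
      rw [hs, Finset.mem_filter] at hz
      have h1 := (Nat.div_eq_iff p.numChunks_pos).1 hz.2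
      have h2 := p.numChunks_pos
      rw [add_mul, one_mul]
      omega
    have hsub : s ⊆ Finset.Ico (s.min' h) (s.min' h + 2 ^ p.d) := by
      intro z hz
      refine Finset.mem_Ico.2 ⟨s.min'_le z hz, ?_⟩
      have h1 := hmem _ (s.min'_mem h)
      have h2 := hmem z hz
      have h3 := p.numChunks_le hd hP
      refine lt_of_mul_lt_mul_right (a := p.P) ?_ (Nat.zero_le _)
      rw [add_mul]
      nlinarith
    exact (Finset.card_le_card hsub).trans (by simp)

lemma chunkOf_mem {C : Fin p.d → ℕ} (hC : C ∈ p.cells) :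
    p.chunkOf C ∈ Fintype.piFinset fun _ : Fin p.d => Finset.range (2 ^ p.depth) := by
  refine Fintype.mem_piFinset.2 fun j => ?_
  have h := Fintype.mem_piFinset.1 hC j
  rw [Finset.mem_range] at h ⊢
  exact (Nat.div_lt_iff_lt_mul p.one_le_cellsPerChunkDim).2 h

open Classical in
lemma mem_generatedCells {i : Fin p.P} {C' : Fin p.d → ℕ} :
    C' ∈ p.generatedCells i ↔ C' ∈ p.cells ∧ ∃ C ∈ p.localCells i, p.Neighbor C C' :=
  Finset.mem_filter

lemma generatedCells_subset_cells (i : Fin p.P) : p.generatedCells i ⊆ p.cells :=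
  fun _ hC => (p.mem_generatedCells.1 hC).1

lemma card_generatedChunks_le (i : Fin p.P) : (p.generatedChunks i).card ≤ p.numChunks := by
  calc _ ≤ (Fintype.piFinset fun _ : Fin p.d => Finset.range (2 ^ p.depth)).card :=
        Finset.card_le_card <| Finset.image_subset_iff.2 fun C hC =>
          p.chunkOf_mem (p.generatedCells_subset_cells i hC)
    _ = _ := by simp [numChunks, ← pow_mul, mul_comm]

lemma card_fiber_chunkOf_le (s : Finset (Fin p.d → ℕ)) (Q : Fin p.d → ℕ) :
    (s.filter fun C => p.chunkOf C = Q).card ≤ p.cellsPerChunkDim ^ p.d := by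
  calc _ ≤ (Fintype.piFinset fun j : Fin p.d => Finset.Ico (Q j * p.cellsPerChunkDim)
          (Q j * p.cellsPerChunkDim + p.cellsPerChunkDim)).card := by
        refine Finset.card_le_card fun C hC => Fintype.mem_piFinset.2 fun j => ?_
        have h := (Nat.div_eq_iff p.one_le_cellsPerChunkDim).1
          (congrFun (Finset.mem_filter.1 hC).2 j)
        have := p.one_le_cellsPerChunkDim
        rw [Finset.mem_Ico]
        omega
    _ = _ := by simp

lemma card_localCells_le (hd : 1 ≤ p.d) (i : Fin p.P) :
    (p.localCells i).card ≤ 2 ^ p.d * p.cellsPerChunkDim ^ p.d := by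
  have h := Finset.card_le_mul_card_image_of_maps_to (s := p.localCells i)
    (t := p.localChunks i) (f := p.chunkOf) (fun C hC => (Finset.mem_filter.1 hC).2) _
    (fun Q _ => p.card_fiber_chunkOf_le _ Q)
  rw [mul_comm]
  exact h.trans (Nat.mul_le_mul_left _ (p.card_localChunks_le hd i))

lemma card_generatedCells_le (i : Fin p.P) :
    (p.generatedCells i).card ≤ (p.generatedChunks i).card * p.cellsPerChunkDim ^ p.d := by
  rw [mul_comm]
  exact Finset.card_le_mul_card_image _ _ fun Q _ => p.card_fiber_chunkOf_le _ Q

lemma div_le_div_add_one {a b g : ℕ} (hg : 1 ≤ g) (h : a ≤ b + 1) : a / g ≤ b / g + 1 := by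
  calc a / g ≤ (b + g) / g := Nat.div_le_div_right (by omega)
    _ = b / g + 1 := Nat.add_div_right _ hg

/-- Since g ≥ 1, cells whose coordinates differ by at most 1 lie in chunks whose coordinates differ
by at most 1. So each local chunk accounts for at most 3^d generated ones. -/
lemma card_generatedChunks_le_of_reach (hd : 1 ≤ p.d) (hR : p.reach ≤ 1) (i : Fin p.P) :
    (p.generatedChunks i).card ≤ 2 ^ p.d * 3 ^ p.d := by
  have hsub : p.generatedChunks i ⊆ (p.localChunks i).biUnion fun Q =>
      Fintype.piFinset fun j => Finset.Icc (Q j - 1) (Q j + 1) := by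
    intro Q' hQ'
    obtain ⟨C', hC', rfl⟩ := Finset.mem_image.1 hQ'
    obtain ⟨C, hC, hn⟩ := (p.mem_generatedCells.1 hC').2
    refine Finset.mem_biUnion.2 ⟨p.chunkOf C, (Finset.mem_filter.1 hC).2,
      Fintype.mem_piFinset.2 fun j => Finset.mem_Icc.2 ?_⟩
    have h1 := div_le_div_add_one p.one_le_cellsPerChunkDim
      ((hn j).1.trans (Nat.add_le_add_left hR _))
    have h2 := div_le_div_add_one p.one_le_cellsPerChunkDim
      ((hn j).2.trans (Nat.add_le_add_left hR _))
    simp only [chunkOf]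
    exact ⟨Nat.sub_le_of_le_add h1, h2⟩
  refine (Finset.card_le_card hsub).trans ((Finset.card_biUnion_le_card_mul _ _ (3 ^ p.d)
    fun Q _ => ?_).trans (Nat.mul_le_mul_right _ (p.card_localChunks_le hd i)))
  rw [Fintype.card_piFinset]
  calc ∏ j, (Finset.Icc (Q j - 1) (Q j + 1)).card ≤ ∏ _j : Fin p.d, 3 :=
        Finset.prod_le_prod' fun j _ => by simp; omega
    _ = _ := by simp

open Classical in
-- The clipping to the cube is kept in the bound because for large r the reach may exceed the whole
-- grid.
lemma card_neighbors_le (C : Fin p.d → ℕ) (s : Finset (Fin p.d → ℕ)) (hs : s ⊆ p.cells) :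
    (s.filter fun C' => p.Neighbor C C').card ≤
      (min (2 * p.reach + 1) p.cellsPerDim) ^ p.d := by
  calc _ ≤ (Fintype.piFinset fun j : Fin p.d => Finset.Icc (C j - p.reach) (C j + p.reach) ∩
          Finset.range p.cellsPerDim).card := by
        refine Finset.card_le_card fun C' hC' => Fintype.mem_piFinset.2 fun j => ?_
        have h1 := Fintype.mem_piFinset.1 (hs (Finset.mem_filter.1 hC').1) j
        have h2 := (Finset.mem_filter.1 hC').2 j
        refine Finset.mem_inter.2 ⟨Finset.mem_Icc.2 (by omega), h1⟩
    _ ≤ ∏ _j : Fin p.d, min (2 * p.reach + 1) p.cellsPerDim := by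
        rw [Fintype.card_piFinset]
        refine Finset.prod_le_prod' fun j _ => le_min ?_ ?_
        · exact (Finset.card_le_card Finset.inter_subset_left).trans (by simp; omega)
        · exact (Finset.card_le_card Finset.inter_subset_right).trans (by simp)
    _ = _ := by simp

lemma neighbor_comm {C C' : Fin p.d → ℕ} : p.Neighbor C C' ↔ p.Neighbor C' C :=
  forall_congr' fun _ => and_comm

open Classical in
/-- The pairs of cells counted by `cellVisits`. -/
noncomputable def visits (i : Fin p.P) : Finset ((Fin p.d → ℕ) × (Fin p.d → ℕ)) :=
  (p.localCells i ×ˢ p.cells).filter fun q => p.Neighbor q.1 q.2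

open Classical in
lemma mem_visits {i : Fin p.P} {q : (Fin p.d → ℕ) × (Fin p.d → ℕ)} :
    q ∈ p.visits i ↔ q.1 ∈ p.localCells i ∧ q.2 ∈ p.cells ∧ p.Neighbor q.1 q.2 := by
  rw [visits, Finset.mem_filter, Finset.mem_product, and_assoc]

lemma card_visits (i : Fin p.P) : (p.visits i).card = p.cellVisits i := rfl

lemma cellVisits_le (hd : 1 ≤ p.d) (i : Fin p.P) :
    p.cellVisits i ≤ 2 ^ p.d * p.cellsPerChunkDim ^ p.d *
      (min (2 * p.reach + 1) p.cellsPerDim) ^ p.d := by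
  classical
  rw [cellVisits, Finset.card_filter, Finset.sum_product]
  simp_rw [← Finset.card_filter]
  refine (Finset.sum_le_card_nsmul _ _ _ fun C _ =>
    p.card_neighbors_le C _ subset_rfl).trans ?_
  exact Nat.mul_le_mul_right _ (p.card_localCells_le hd i)

lemma localCells_subset_generatedCells (i : Fin p.P) :
    p.localCells i ⊆ p.generatedCells i := fun C hC => by
  refine p.mem_generatedCells.2 ⟨(Finset.mem_filter.1 hC).1, C, hC, fun j => ?_⟩
  constructor <;> exact Nat.le_add_right _ _

lemma card_generatedCells_le_cellVisits (i : Fin p.P) :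
    (p.generatedCells i).card ≤ p.cellVisits i := by
  classical
  rw [← card_visits]
  refine (Finset.card_le_card (t := (p.visits i).image Prod.snd) fun C' hC' => ?_).trans
    Finset.card_image_le
  obtain ⟨h1, C, hC, hn⟩ := p.mem_generatedCells.1 hC'
  exact Finset.mem_image.2 ⟨(C, C'), p.mem_visits.2 ⟨hC, h1, hn⟩, rfl⟩

lemma visits_subset (i : Fin p.P) : p.visits i ⊆ p.generatedCells i ×ˢ p.generatedCells i := by
  intro q hq
  obtain ⟨h3, h4, h2⟩ := p.mem_visits.1 hq
  exact Finset.mem_product.2 ⟨p.localCells_subset_generatedCells i h3,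
    p.mem_generatedCells.2 ⟨h4, _, h3, h2⟩⟩

/-- Enlarging the visits to all neighboring pairs of generated cells makes the relation symmetric,
so a cell occurs in either coordinate at most as often as it has neighbors. -/
lemma sum_visits_fst_le (i : Fin p.P) (f : (Fin p.d → ℕ) → ℕ) :
    ∑ q ∈ p.visits i, f q.1 ≤ (min (2 * p.reach + 1) p.cellsPerDim) ^ p.d *
      ∑ C ∈ p.generatedCells i, f C := by
  classical
  calc ∑ q ∈ p.visits i, f q.1
      ≤ ∑ q ∈ (p.generatedCells i ×ˢ p.generatedCells i).filter
          (fun q => p.Neighbor q.1 q.2), f q.1 :=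
        Finset.sum_le_sum_of_subset fun q hq =>
          Finset.mem_filter.2 ⟨p.visits_subset i hq, (p.mem_visits.1 hq).2.2⟩
    _ = ∑ C ∈ p.generatedCells i,
          ((p.generatedCells i).filter fun C' => p.Neighbor C C').card * f C := by
        rw [Finset.sum_filter, Finset.sum_product]
        refine Finset.sum_congr rfl fun C _ => ?_
        rw [← Finset.sum_filter, ← smul_eq_mul]
        exact Finset.sum_const (f C)
    _ ≤ _ := by
        rw [Finset.mul_sum]
        gcongr
        exact p.card_neighbors_le _ _ (p.generatedCells_subset_cells i)

lemma sum_visits_snd_le (i : Fin p.P) (f : (Fin p.d → ℕ) → ℕ) :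
    ∑ q ∈ p.visits i, f q.2 ≤ (min (2 * p.reach + 1) p.cellsPerDim) ^ p.d *
      ∑ C ∈ p.generatedCells i, f C := by
  classical
  calc ∑ q ∈ p.visits i, f q.2
      ≤ ∑ q ∈ (p.generatedCells i ×ˢ p.generatedCells i).filter
          (fun q => p.Neighbor q.1 q.2), f q.2 :=
        Finset.sum_le_sum_of_subset fun q hq =>
          Finset.mem_filter.2 ⟨p.visits_subset i hq, (p.mem_visits.1 hq).2.2⟩
    _ = ∑ C ∈ p.generatedCells i,
          ((p.generatedCells i).filter fun C' => p.Neighbor C C').card * f C := by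
        rw [Finset.sum_filter, Finset.sum_product_right]
        refine Finset.sum_congr rfl fun C _ => ?_
        simp_rw [p.neighbor_comm (C' := C)]
        rw [← Finset.sum_filter, ← smul_eq_mul]
        exact Finset.sum_const (f C)
    _ ≤ _ := by
        rw [Finset.mul_sum]
        gcongr
        exact p.card_neighbors_le _ _ (p.generatedCells_subset_cells i)

/-- The cells of the points. -/
noncomputable def labels (X : Fin p.n → Fin p.d → ℝ) : Fin p.n → Fin p.d → ℕ :=
  fun u => p.cellOf (X u)

/-! ### Point-dependent work in terms of occupancies -/

lemma vertexSamples_eq (i : Fin p.P) (X : Fin p.n → Fin p.d → ℝ) :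
    p.vertexSamples i X = ∑ C ∈ p.generatedCells i, occ (p.labels X) C := by
  rw [sum_occ_eq_card]; rfl

lemma cellOf_mem_cells {x : Fin p.d → ℝ} (hx : ∀ j, x j ∈ Set.Ico (0 : ℝ) 1) :
    p.cellOf x ∈ p.cells :=
  Fintype.mem_piFinset.2 fun j => floor_mul_mem_range (hx j) p.cellsPerDim_pos

/-- The local cell of a compared pair may be that of either point, while a visit has it first; the
swapped copy of the pairs accounts for the factor 2. -/
lemma distanceComputations_le (i : Fin p.P) {X : Fin p.n → Fin p.d → ℝ} (hX : InCube X) :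
    p.distanceComputations i X ≤
      2 * ∑ q ∈ p.visits i, occ (p.labels X) q.1 * occ (p.labels X) q.2 := by
  classical
  rw [sum_occ_mul_occ_eq_card, two_mul]
  set A := Finset.univ.filter fun q : Fin p.n × Fin p.n =>
    (p.labels X q.1, p.labels X q.2) ∈ p.visits i with hA
  refine (Finset.card_le_card (t := A ∪ A.image Prod.swap) fun q hq => ?_).trans
    ((Finset.card_union_le _ _).trans (Nat.add_le_add_left Finset.card_image_le _))
  have hA' : ∀ u v, p.cellOf (X u) ∈ p.localCells i →
      p.Neighbor (p.cellOf (X u)) (p.cellOf (X v)) → (u, v) ∈ A := fun u v h1 h2 =>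
    Finset.mem_filter.2 ⟨Finset.mem_univ _, p.mem_visits.2
      ⟨h1, p.cellOf_mem_cells (hX v), h2⟩⟩
  obtain ⟨-, -, hn, h | h⟩ := Finset.mem_filter.1 hq
  · exact Finset.mem_union_left _ (hA' _ _ h hn)
  · exact Finset.mem_union_right _ (Finset.mem_image.2
      ⟨q.swap, hA' _ _ h (p.neighbor_comm.1 hn), Prod.swap_swap q⟩)

/-- The point-dependent work in terms of the squared occupancies of the generated cells. -/
lemma vertexSamples_add_distanceComputations_le (i : Fin p.P) {X : Fin p.n → Fin p.d → ℝ}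
    (hX : InCube X) :
    p.vertexSamples i X + p.distanceComputations i X ≤
      (1 + 2 * (min (2 * p.reach + 1) p.cellsPerDim) ^ p.d) *
        ∑ C ∈ p.generatedCells i, occ (p.labels X) C ^ 2 := by
  have h1 : p.vertexSamples i X ≤ ∑ C ∈ p.generatedCells i, occ (p.labels X) C ^ 2 := by
    rw [vertexSamples_eq]
    exact Finset.sum_le_sum fun C _ => Nat.le_self_pow two_ne_zero _
  -- 2xy ≤ x² + y² decouples the two cells of a visit, after which each square is counted once per
  -- neighbor.
  have h2 : 2 * ∑ q ∈ p.visits i, occ (p.labels X) q.1 * occ (p.labels X) q.2 ≤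
      ∑ q ∈ p.visits i, occ (p.labels X) q.1 ^ 2 + ∑ q ∈ p.visits i, occ (p.labels X) q.2 ^ 2 := by
    rw [Finset.mul_sum, ← Finset.sum_add_distrib]
    refine Finset.sum_le_sum fun q _ => ?_
    rw [← mul_assoc]
    exact two_mul_le_add_sq _ _
  have h3 := p.sum_visits_fst_le i fun C => occ (p.labels X) C ^ 2
  have h4 := p.sum_visits_snd_le i fun C => occ (p.labels X) C ^ 2
  have h5 := p.distanceComputations_le i hX
  rw [add_mul, one_mul]
  linarith

/-- The point-dependent work in terms of the largest occupancy. -/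
lemma vertexSamples_add_distanceComputations_le_of_occ_le (i : Fin p.P)
    {X : Fin p.n → Fin p.d → ℝ} (hX : InCube X) {β : ℝ} (hβ : 1 ≤ β)
    (hocc : ∀ C ∈ p.cells, (occ (p.labels X) C : ℝ) ≤ β) :
    (p.vertexSamples i X + p.distanceComputations i X : ℝ) ≤ 3 * p.cellVisits i * β ^ 2 := by
  have h1 : (p.vertexSamples i X : ℝ) ≤ p.cellVisits i * β ^ 2 := by
    rw [vertexSamples_eq]
    push_cast
    refine (Finset.sum_le_card_nsmul _ _ β fun C hC =>
      hocc C (p.generatedCells_subset_cells i hC)).trans ?_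
    rw [nsmul_eq_mul]
    have : ((p.generatedCells i).card : ℝ) ≤ p.cellVisits i := by
      exact_mod_cast p.card_generatedCells_le_cellVisits i
    gcongr
    nlinarith
  have h2 : (p.distanceComputations i X : ℝ) ≤ 2 * (p.cellVisits i * β ^ 2) := by
    have h3 : (p.distanceComputations i X : ℝ) ≤
        2 * ∑ q ∈ p.visits i, (occ (p.labels X) q.1 : ℝ) * occ (p.labels X) q.2 := by
      exact_mod_cast p.distanceComputations_le i hX
    refine h3.trans (mul_le_mul_of_nonneg_left ?_ zero_le_two)
    rw [← card_visits, ← nsmul_eq_mul]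
    refine Finset.sum_le_card_nsmul _ _ _ fun q hq => ?_
    have hq' := Finset.mem_product.1 (p.visits_subset i hq)
    have h4 := hocc _ (p.generatedCells_subset_cells i hq'.1)
    have h5 := hocc _ (p.generatedCells_subset_cells i hq'.2)
    rw [sq]
    gcongr
  linarith

/-! ### Law of the cells and simultaneous concentration -/

lemma measurable_cellOf : Measurable p.cellOf :=
  measurable_pi_lambda _ fun j => Nat.measurable_floor.comp (by fun_prop)

/-- The distribution of the cell of a uniform point. -/
noncomputable def cellLaw : Measure (Fin p.d → ℕ) :=
  (Measure.pi fun _ : Fin p.d => volume.restrict (Set.Ico (0 : ℝ) 1)).map p.cellOf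

instance : IsProbabilityMeasure p.cellLaw := by
  have : IsProbabilityMeasure (volume.restrict (Set.Ico (0 : ℝ) 1)) := ⟨by simp⟩
  exact Measure.isProbabilityMeasure_map p.measurable_cellOf.aemeasurable

/-- The cells of independent points are independent and identically distributed, which moves the
problem to the discrete setting of the occupancy bounds. -/
lemma map_labels :
    (uniformPoints p.n p.d).map p.labels = Measure.pi fun _ => p.cellLaw := by
  have : IsProbabilityMeasure (volume.restrict (Set.Ico (0 : ℝ) 1)) := ⟨by simp⟩
  have : IsProbabilityMeasure
      ((Measure.pi fun _ : Fin p.d => volume.restrict (Set.Ico (0 : ℝ) 1)).map p.cellOf) :=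
    inferInstanceAs (IsProbabilityMeasure p.cellLaw)
  exact Measure.pi_map_pi fun _ => p.measurable_cellOf.aemeasurable

lemma measurable_labels : Measurable p.labels :=
  measurable_pi_lambda _ fun u => p.measurable_cellOf.comp (measurable_pi_apply u)

lemma uniformPoints_labels (s : Set (Fin p.n → Fin p.d → ℕ)) :
    uniformPoints p.n p.d {X | p.labels X ∈ s} = (Measure.pi fun _ => p.cellLaw) s := by
  rw [← map_labels, Measure.map_apply p.measurable_labels (MeasurableSet.of_discrete)]
  rfl

lemma volume_floor_eq_le {G : ℕ} (hG : 0 < G) (c : ℕ) :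
    volume.restrict (Set.Ico (0 : ℝ) 1) {t | ⌊t * G⌋₊ = c} ≤ ENNReal.ofReal (1 / G) := by
  have hG' : (0 : ℝ) < G := by exact_mod_cast hG
  rw [Measure.restrict_apply' measurableSet_Ico]
  calc _ ≤ volume (Set.Ico ((c : ℝ) / G) ((c + 1 : ℝ) / G)) := by
        refine measure_mono fun t ht => ?_
        have h := (Nat.floor_eq_iff (mul_nonneg ht.2.1 hG'.le)).1 ht.1
        exact ⟨(div_le_iff₀ hG').2 h.1, (lt_div_iff₀ hG').2 h.2⟩
    _ = _ := by rw [Real.volume_Ico]; congr 1; ring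

lemma cellLaw_singleton_le (C : Fin p.d → ℕ) :
    p.cellLaw {C} ≤ ENNReal.ofReal (1 / (p.cellsPerDim : ℝ) ^ p.d) := by
  rw [cellLaw, Measure.map_apply p.measurable_cellOf (measurableSet_singleton C)]
  have e : p.cellOf ⁻¹' {C} =
      Set.univ.pi fun j => {t : ℝ | ⌊t * p.cellsPerDim⌋₊ = C j} := by
    ext x
    simp [cellOf, funext_iff]
  rw [e, Measure.pi_pi, ← one_div_pow, ENNReal.ofReal_pow (by positivity)]
  exact (Finset.prod_le_prod' fun j _ => volume_floor_eq_le p.cellsPerDim_pos (C j)).trans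
    (by simp)

lemma card_cells : p.cells.card = p.cellsPerDim ^ p.d := by simp [cells]

/-- With high probability all occupancies, and for every PE the sum of the squared occupancies of
the generated cells, are close to their expected values. -/
lemma occupancy_concentration {c : ℝ} (hc : 0 < c) {μ β σ : ℝ} (hn : 2 ≤ p.n) (hP : p.P ≤ p.n)
    (hμ : μ = p.n / (p.cellsPerDim : ℝ) ^ p.d) (hG : p.cellsPerDim ^ p.d ≤ p.n)
    (hβ : β = 2 * μ + (c + 2) * Real.log p.n)
    (hσ : ∀ i, ((p.generatedCells i).card : ℝ) ≤ σ)
    (hσβ : (c + 2) * Real.log p.n ≤ 2 * σ * (μ + 2 * μ ^ 2) / (2 * β + 1 + 4 * μ)) :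
    uniformPoints p.n p.d {X | ¬ (InCube X ∧ (∀ C ∈ p.cells, (occ (p.labels X) C : ℝ) ≤ β) ∧
      ∀ i, ∑ C ∈ p.generatedCells i, (occ (p.labels X) C : ℝ) ^ 2 ≤
        4 * σ * (μ + 2 * μ ^ 2))} ≤ ENNReal.ofReal ((p.n : ℝ) ^ (-c)) := by
  have hn0 : (0 : ℝ) < p.n := by exact_mod_cast (by omega : 0 < p.n)
  have hlog : 0 ≤ Real.log p.n := Real.log_nonneg (by exact_mod_cast (by omega : 1 ≤ p.n))
  have hμ0 : 0 ≤ μ := hμ ▸ by positivity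
  have hβ0 : 0 ≤ β := hβ ▸ by positivity
  -- Each bad event has probability at most n^(-(c+2)), which leaves a factor n² for the union
  -- bound.
  set ε := ENNReal.ofReal (Real.exp (-((c + 2) * Real.log p.n))) with hε
  have hμ' : μ = p.n * (1 / (p.cellsPerDim : ℝ) ^ p.d) := by rw [hμ]; ring
  have hpp : 0 ≤ 1 / (p.cellsPerDim : ℝ) ^ p.d := by positivity
  have h1 : ∀ C ∈ p.cells, uniformPoints p.n p.d {X | β < (occ (p.labels X) C : ℝ)} ≤ ε := by
    intro C _
    have h := measure_occ_gt_le p.cellLaw hpp (p.cellLaw_singleton_le C) p.n β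
    rw [← uniformPoints_labels, ← hμ'] at h
    refine h.trans (ENNReal.ofReal_le_ofReal (Real.exp_le_exp.2 ?_))
    rw [hβ]; linarith
  have h2 : ∀ i : Fin p.P, uniformPoints p.n p.d
      {X | (∀ C ∈ p.generatedCells i, (occ (p.labels X) C : ℝ) ≤ β) ∧
        4 * σ * (μ + 2 * μ ^ 2) < ∑ C ∈ p.generatedCells i, (occ (p.labels X) C : ℝ) ^ 2} ≤ ε := by
    intro i
    have h := measure_sum_sq_occ_gt_le p.cellLaw (p.generatedCells i) hpp
      (fun C _ => p.cellLaw_singleton_le C) hβ0 (hσ i) p.n hμ'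
    rw [← uniformPoints_labels] at h
    exact h.trans (ENNReal.ofReal_le_ofReal (Real.exp_le_exp.2 (neg_le_neg hσβ)))
  have hsub : {X | ¬ (InCube X ∧ (∀ C ∈ p.cells, (occ (p.labels X) C : ℝ) ≤ β) ∧
      ∀ i, ∑ C ∈ p.generatedCells i, (occ (p.labels X) C : ℝ) ^ 2 ≤ 4 * σ * (μ + 2 * μ ^ 2))} ⊆
      {X | ¬ InCube X} ∪ ((⋃ C ∈ p.cells, {X | β < (occ (p.labels X) C : ℝ)}) ∪
      ⋃ i ∈ (Finset.univ : Finset (Fin p.P)),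
        {X | (∀ C ∈ p.generatedCells i, (occ (p.labels X) C : ℝ) ≤ β) ∧
        4 * σ * (μ + 2 * μ ^ 2) <
          ∑ C ∈ p.generatedCells i, (occ (p.labels X) C : ℝ) ^ 2}) := by
    intro X hX
    by_contra hcon
    simp only [Set.mem_union, Set.mem_iUnion, Set.mem_ofPred_eq, not_or, not_exists, not_not,
      not_lt, not_and, Finset.mem_univ, true_implies] at hcon
    exact hX ⟨hcon.1, hcon.2.1, fun i => hcon.2.2 i fun C hC =>
      hcon.2.1 C (p.generatedCells_subset_cells i hC)⟩
  refine (measure_mono hsub).trans ((measure_union_le _ _).trans ?_)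
  have h0 : uniformPoints p.n p.d {X | ¬ InCube X} = 0 := ae_inCube p.n p.d
  rw [h0, zero_add]
  refine (measure_union_le _ _).trans ((add_le_add
    ((measure_biUnion_finset_le _ _).trans (Finset.sum_le_card_nsmul _ _ _ h1))
    ((measure_biUnion_finset_le _ _).trans
      (Finset.sum_le_card_nsmul _ _ _ fun i _ => h2 i))).trans ?_)
  rw [← add_nsmul, nsmul_eq_mul, card_cells, Finset.card_fin]
  -- There is one event per cell and one per PE, at most 2n ≤ n² in total; this is where n ≥ 2 is
  -- used.
  have h3 : ((p.cellsPerDim ^ p.d + p.P : ℕ) : ENNReal) ≤ ENNReal.ofReal ((p.n : ℝ) ^ (2 : ℝ)) := by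
    rw [← ENNReal.ofReal_natCast]
    refine ENNReal.ofReal_le_ofReal ?_
    have : p.cellsPerDim ^ p.d + p.P ≤ p.n ^ 2 := by nlinarith
    exact_mod_cast this
  have h4 : ε = ENNReal.ofReal ((p.n : ℝ) ^ (-(c + 2))) := by
    rw [hε, Real.rpow_def_of_pos hn0]; congr 2; ring
  refine (mul_le_mul_left h3 _).trans (le_of_eq ?_)
  rw [h4, ← ENNReal.ofReal_mul (by positivity), ← Real.rpow_add hn0]
  congr 2; ring

/-! ### Cell size in terms of n and r -/

lemma numChunks_eq_two_pow_pow : ((2 : ℝ) ^ p.depth) ^ p.d = p.numChunks := by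
  rw [numChunks]; push_cast; rw [← pow_mul, mul_comm]

lemma rpow_neg_one_div_pow (hd : 1 ≤ p.d) :
    ((p.n : ℝ) ^ (-(1 : ℝ) / p.d)) ^ p.d = 1 / p.n := by
  have : (p.d : ℝ) ≠ 0 := by exact_mod_cast (by omega : p.d ≠ 0)
  rw [← Real.rpow_natCast, ← Real.rpow_mul (by positivity), div_mul_cancel₀ _ this,
    Real.rpow_neg_one, one_div]

/-- If the chunks have side length at least `r`, the side length of a cell lies between
`max(r, n^(-1/d))` and its double. -/
lemma cellsPerDim_bounds (hd : 1 ≤ p.d) (hn : 1 ≤ p.n) (hr : 0 < p.r)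
    (hrb : p.r ≤ 1 / 2 ^ p.depth) (hk : p.numChunks ≤ p.n) :
    p.cellsPerDim * max p.r ((p.n : ℝ) ^ (-(1 : ℝ) / p.d)) ≤ 1 ∧
    1 ≤ 2 * p.cellsPerDim * max p.r ((p.n : ℝ) ^ (-(1 : ℝ) / p.d)) := by
  set M := max p.r ((p.n : ℝ) ^ (-(1 : ℝ) / p.d)) with hM
  have hM0 : 0 < M := lt_max_of_lt_left hr
  have hB : (0 : ℝ) < 2 ^ p.depth := by positivity
  have hMB : M ≤ 1 / 2 ^ p.depth := by
    refine max_le hrb ((pow_le_pow_iff_left₀ (by positivity) (by positivity)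
      (by omega : p.d ≠ 0)).1 ?_)
    rw [p.rpow_neg_one_div_pow hd, one_div_pow, numChunks_eq_two_pow_pow]
    exact one_div_le_one_div_of_le (by exact_mod_cast p.numChunks_pos) (by exact_mod_cast hk)
  set y := (1 : ℝ) / 2 ^ p.depth / M with hy
  have hy1 : 1 ≤ y := by rwa [hy, le_div_iff₀ hM0, one_mul]
  have hyM : 2 ^ p.depth * y * M = 1 := by rw [hy]; field_simp
  -- The quotient is at least 1, so the `max 1` in the definition of g is inactive and rounding down
  -- loses at most a factor 2.
  have hfl : 1 ≤ ⌊y⌋₊ := Nat.le_floor (by simpa using hy1)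
  have hg : p.cellsPerChunkDim = ⌊y⌋₊ := max_eq_right hfl
  have h1 : (⌊y⌋₊ : ℝ) ≤ y := Nat.floor_le (by linarith)
  have h2 : y ≤ 2 * ⌊y⌋₊ := by
    have := Nat.lt_floor_add_one y
    have : (1 : ℝ) ≤ ⌊y⌋₊ := by exact_mod_cast hfl
    linarith
  have hG : (p.cellsPerDim : ℝ) = 2 ^ p.depth * ⌊y⌋₊ := by rw [cellsPerDim, hg]; push_cast; rfl
  rw [hG]
  constructor
  · calc (2 : ℝ) ^ p.depth * ⌊y⌋₊ * M ≤ 2 ^ p.depth * y * M := by gcongr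
      _ = 1 := hyM
  · calc 1 = 2 ^ p.depth * y * M := hyM.symm
      _ ≤ 2 ^ p.depth * (2 * ⌊y⌋₊) * M := by gcongr
      _ = _ := by ring

lemma reach_le_one (hd : 1 ≤ p.d) (hn : 1 ≤ p.n) (hr : 0 < p.r)
    (hrb : p.r ≤ 1 / 2 ^ p.depth) (hk : p.numChunks ≤ p.n) : p.reach ≤ 1 := by
  rw [reach, Nat.ceil_le, Nat.cast_one, mul_comm]
  exact (mul_le_mul_of_nonneg_left (le_max_left _ _) (by positivity)).trans
    (p.cellsPerDim_bounds hd hn hr hrb hk).1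

lemma cellsPerDim_pow_le (hd : 1 ≤ p.d) (hn : 1 ≤ p.n) (hr : 0 < p.r)
    (hrb : p.r ≤ 1 / 2 ^ p.depth) (hk : p.numChunks ≤ p.n) : p.cellsPerDim ^ p.d ≤ p.n := by
  have hn' : (0 : ℝ) < p.n := by exact_mod_cast hn
  have h := (mul_le_mul_of_nonneg_left (le_max_right p.r ((p.n : ℝ) ^ (-(1 : ℝ) / p.d)))
    (by positivity : (0 : ℝ) ≤ p.cellsPerDim)).trans (p.cellsPerDim_bounds hd hn hr hrb hk).1
  have h2 := pow_le_one₀ (n := p.d) (by positivity) h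
  rw [mul_pow, p.rpow_neg_one_div_pow hd, mul_one_div, div_le_one hn'] at h2
  exact_mod_cast h2

/-- The cell side is at most 2 max(r, n^(-1/d)), and the d-th power of this maximum is at most r^d +
1/n. This compares n²/G^d, the order of the number of pairs of points sharing a cell, with `size`.
-/
lemma sq_le_cellsPerDim_pow_mul (hd : 1 ≤ p.d) (hn : 1 ≤ p.n) (hr : 0 < p.r)
    (hrb : p.r ≤ 1 / 2 ^ p.depth) (hk : p.numChunks ≤ p.n) :
    (p.n : ℝ) ^ 2 ≤ 2 ^ p.d * (p.cellsPerDim : ℝ) ^ p.d * (p.n ^ 2 * (min p.r 1) ^ p.d + p.n) := by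
  have hn' : (0 : ℝ) < p.n := by exact_mod_cast hn
  have hr1 : p.r ≤ 1 := hrb.trans ((div_le_one (by positivity)).2 (one_le_pow₀ one_le_two))
  have h := one_le_pow₀ (n := p.d) (p.cellsPerDim_bounds hd hn hr hrb hk).2
  have hmax : (max p.r ((p.n : ℝ) ^ (-(1 : ℝ) / p.d))) ^ p.d ≤ p.r ^ p.d + 1 / p.n := by
    rw [← p.rpow_neg_one_div_pow hd]
    rcases le_total p.r ((p.n : ℝ) ^ (-(1 : ℝ) / p.d)) with h | h
    · rw [max_eq_right h]; exact le_add_of_nonneg_left (by positivity)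
    · rw [max_eq_left h]; exact le_add_of_nonneg_right (by positivity)
  rw [mul_pow, mul_pow] at h
  rw [min_eq_left hr1]
  calc (p.n : ℝ) ^ 2 = p.n ^ 2 * 1 := (mul_one _).symm
    _ ≤ p.n ^ 2 * (2 ^ p.d * (p.cellsPerDim : ℝ) ^ p.d * (p.r ^ p.d + 1 / p.n)) := by
        gcongr; exact h.trans (by gcongr)
    _ = _ := by field_simp

lemma cellsPerChunkDim_eq_one (hr : 0 < p.r) (hrb : 1 / 2 ^ p.depth < p.r) :
    p.cellsPerChunkDim = 1 := by
  rw [cellsPerChunkDim, Nat.floor_eq_zero.2, max_eq_left zero_le_one]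
  rw [div_lt_one (lt_max_of_lt_left hr)]
  exact lt_max_of_lt_left hrb

/-- Cells are chunks here, of side less than r, so rG ≥ 1 and 2⌈rG⌉ + 1 ≤ 2rG + 3 ≤ 5rG. For r ≥ 1
the clipping to G takes over. -/
lemma min_reach_le (hr : 0 < p.r) (hrb : 1 / 2 ^ p.depth < p.r) :
    ((min (2 * p.reach + 1) p.cellsPerDim : ℕ) : ℝ) ≤ 5 * min p.r 1 * p.cellsPerDim := by
  have hG : (p.cellsPerDim : ℝ) = 2 ^ p.depth := by
    rw [cellsPerDim, p.cellsPerChunkDim_eq_one hr hrb]; push_cast; ring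
  have h1 : 1 ≤ p.r * p.cellsPerDim := by
    rw [hG, ← div_le_iff₀ (by positivity)]; exact hrb.le
  have h2 : (p.reach : ℝ) ≤ p.r * p.cellsPerDim + 1 :=
    (Nat.ceil_lt_add_one (by linarith)).le
  push_cast
  have h3 : (0 : ℝ) ≤ p.cellsPerDim := by positivity
  rcases le_total p.r 1 with h | h
  · rw [min_eq_left h]
    exact (min_le_left _ _).trans (by linarith)
  · rw [min_eq_right h]
    exact (min_le_right _ _).trans (by linarith)

/-! ### Absorbing the lower-order terms -/

lemma recursionVariates_le (hd : 1 ≤ p.d) (hP : 1 ≤ p.P) (hb : p.P * p.P * p.depth ≤ p.n)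
    (i : Fin p.P) : (p.recursionVariates i : ℝ) ≤ 4 ^ p.d * (p.n / p.P) := by
  have hP' : (0 : ℝ) < p.P := by exact_mod_cast hP
  rw [← mul_div_assoc, le_div_iff₀ hP']
  -- Even a PE that reaches all k ≤ 2^d P chunks stays within the bound.
  have h : p.recursionVariates i * p.P ≤ 4 ^ p.d * p.n := by
    calc p.recursionVariates i * p.P ≤ (2 ^ p.d * p.P) * (p.depth * 2 ^ p.d) * p.P := by
          rw [recursionVariates]
          gcongr
          · exact (p.card_generatedChunks_le i).trans (p.numChunks_le hd hP)
          · exact Nat.sub_le _ _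
      _ = (2 * 2) ^ p.d * (p.P * p.P * p.depth) := by rw [mul_pow]; ring
      _ ≤ _ := by norm_num; gcongr
  exact_mod_cast h

lemma log_le_four_mul_sqrt {x : ℝ} (hx : 1 ≤ x) : Real.log x ≤ 4 * √x := by
  have h := Real.log_le_rpow_div (by linarith : 0 ≤ x) (ε := 1 / 2) (by norm_num)
  rw [← Real.sqrt_eq_rpow] at h
  have := Real.sqrt_nonneg x
  linarith

lemma log_sq_le_sixteen_mul_sqrt {x : ℝ} (hx : 1 ≤ x) : Real.log x ^ 2 ≤ 16 * √x := by
  have h := Real.log_le_rpow_div (by linarith : 0 ≤ x) (ε := 1 / 4) (by norm_num)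
  have h2 : (x ^ (1 / 4 : ℝ)) ^ 2 = √x := by
    rw [Real.sqrt_eq_rpow, ← Real.rpow_natCast, ← Real.rpow_mul (by linarith)]; norm_num
  calc Real.log x ^ 2 ≤ (x ^ (1 / 4 : ℝ) / (1 / 4)) ^ 2 :=
        pow_le_pow_left₀ (Real.log_nonneg hx) h 2
    _ = 16 * √x := by rw [← h2]; ring

/-- From k ≤ 2^d P and kP ≤ n follows k² ≤ 2^d n. Powers of log n, being O(√n), are thereby absorbed
into n/k, the mean number of points in a chunk. -/
lemma sqrt_le_div_numChunks (hd : 1 ≤ p.d) (hP : 1 ≤ p.P)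
    (hk : p.numChunks * p.P ≤ p.n) : √p.n ≤ 2 ^ p.d * (p.n / p.numChunks : ℝ) := by
  have hk0 : (0 : ℝ) < p.numChunks := by exact_mod_cast p.numChunks_pos
  have h1 : (p.numChunks : ℝ) ^ 2 ≤ 2 ^ p.d * p.n := by
    have : p.numChunks ^ 2 ≤ 2 ^ p.d * p.n := by
      calc p.numChunks ^ 2 ≤ p.numChunks * (2 ^ p.d * p.P) := by
            rw [sq]; exact Nat.mul_le_mul_left _ (p.numChunks_le hd hP)
        _ = 2 ^ p.d * (p.numChunks * p.P) := by ring
        _ ≤ _ := Nat.mul_le_mul_left _ hk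
    exact_mod_cast this
  refine Real.sqrt_le_iff.2 ⟨by positivity, ?_⟩
  rw [mul_pow, div_pow, ← mul_div_assoc, le_div_iff₀ (by positivity)]
  have h2 : (1 : ℝ) ≤ 2 ^ p.d := one_le_pow₀ one_le_two
  calc (p.n : ℝ) * p.numChunks ^ 2 ≤ p.n * (2 ^ p.d * p.n) := by gcongr
    _ = 2 ^ p.d * p.n ^ 2 := by ring
    _ ≤ (2 ^ p.d) ^ 2 * p.n ^ 2 := by gcongr; nlinarith

/-- `n^2 min(r,1)^d + n`, which is of the order of the number of edges and vertices. -/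
noncomputable def size : ℝ := (p.n : ℝ) ^ 2 * (min p.r 1) ^ p.d + p.n

/-! ### The work bound for small and for large radius -/

lemma work_eq (i : Fin p.P) (X : Fin p.n → Fin p.d → ℝ) :
    (p.work i X : ℝ) = p.recursionVariates i + p.cellVariates i + p.cellVisits i +
      (p.vertexSamples i X + p.distanceComputations i X) := by
  rw [work]; push_cast; ring

/-- The work bound for `r` at most the side length of a chunk. -/
lemma work_concentration_of_le {c : ℝ} (hc : 0 < c) (hd : 1 ≤ p.d) (hP : 1 ≤ p.P)
    (hn : 2 ≤ p.n) (hr : 0 < p.r) (hrb : p.r ≤ 1 / 2 ^ p.depth)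
    (hb : p.P * p.P * p.depth ≤ p.n) (hk : p.numChunks * p.P ≤ p.n) :
    uniformPoints p.n p.d {X | ¬ (InCube X ∧ ∀ i, (p.work i X : ℝ) ≤
      (4 ^ p.d + 2 * 6 ^ p.d + 36 * 6 ^ p.d * (24 * (c + 2) ^ 2 * 2 ^ p.d + 6 ^ p.d)) *
        (p.size / p.P))} ≤ ENNReal.ofReal ((p.n : ℝ) ^ (-c)) := by
  have hkn : p.numChunks ≤ p.n := (Nat.le_mul_of_pos_right _ hP).trans hk
  have hn1 : 1 ≤ p.n := by omega
  have hP' : (0 : ℝ) < p.P := by exact_mod_cast hP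
  have hn' : (0 : ℝ) < p.n := by exact_mod_cast hn1
  have hR := p.reach_le_one hd hn1 hr hrb hkn
  have hGn := p.cellsPerDim_pow_le hd hn1 hr hrb hkn
  have hk0 : (0 : ℝ) < p.numChunks := by exact_mod_cast p.numChunks_pos
  have hPk : (p.P : ℝ) ≤ p.numChunks := by exact_mod_cast p.le_numChunks hd
  have hg0 : (0 : ℝ) < p.cellsPerChunkDim := by exact_mod_cast p.one_le_cellsPerChunkDim
  have hGk : (p.cellsPerDim : ℝ) ^ p.d = p.numChunks * (p.cellsPerChunkDim : ℝ) ^ p.d := by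
    exact_mod_cast p.cellsPerDim_pow
  -- The summand 6^d covers the generated cells; the other one enlarges σ = B g^d until the tail
  -- exponent reaches (c+2) log n.
  set B : ℝ := 24 * (c + 2) ^ 2 * 2 ^ p.d + 6 ^ p.d with hB
  set gd : ℝ := (p.cellsPerChunkDim : ℝ) ^ p.d with hgd
  have hgd0 : 0 < gd := by positivity
  set μ : ℝ := p.n / (p.cellsPerDim : ℝ) ^ p.d with hμ
  have hG0 : (0 : ℝ) < (p.cellsPerDim : ℝ) ^ p.d := by rw [hGk]; positivity
  have hμ1 : 1 ≤ μ := (one_le_div hG0).2 (by exact_mod_cast hGn)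
  have hgμ : gd * μ = p.n / p.numChunks := by rw [hμ, hGk]; field_simp
  have hnk : (p.n : ℝ) / p.numChunks ≤ p.n / p.P := by gcongr
  have hgn : gd ≤ p.n / p.P := by
    refine le_trans ?_ (hgμ.le.trans hnk)
    nlinarith
  have hGen : ∀ i, ((p.generatedChunks i).card : ℝ) ≤ 6 ^ p.d := fun i => by
    have h := p.card_generatedChunks_le_of_reach hd hR i
    rw [← mul_pow] at h
    exact_mod_cast h
  have hσ : ∀ i, ((p.generatedCells i).card : ℝ) ≤ B * gd := fun i => by
    have h : ((p.generatedCells i).card : ℝ) ≤ (p.generatedChunks i).card * gd := by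
      rw [hgd]; exact_mod_cast p.card_generatedCells_le i
    refine h.trans (mul_le_mul_of_nonneg_right ((hGen i).trans ?_) hgd0.le)
    exact le_add_of_nonneg_left (by positivity)
  have hlog : 0 ≤ Real.log p.n := Real.log_nonneg (by exact_mod_cast hn1)
  -- After the factor 1 + 2μ is cancelled, it suffices that e l (4 + 2 e l) ≤ 2B g^d μ = 2B n/k with
  -- e = c + 2 and l = log n, and the left side is O(e² √n).
  have hnum : (c + 2) * Real.log p.n ≤ 2 * (B * gd) * (μ + 2 * μ ^ 2) /
      (2 * (2 * μ + (c + 2) * Real.log p.n) + 1 + 4 * μ) := by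
    rw [le_div_iff₀ (by positivity)]
    have h1 := log_le_four_mul_sqrt (x := p.n) (by exact_mod_cast hn1)
    have h2 := log_sq_le_sixteen_mul_sqrt (x := p.n) (by exact_mod_cast hn1)
    have h3 := p.sqrt_le_div_numChunks hd hP hk
    set l := Real.log p.n
    set s := √(p.n : ℝ)
    set e := c + 2 with he
    have he1 : 1 ≤ e := by linarith
    have hs : 0 ≤ s := Real.sqrt_nonneg _
    have h4 : e * l * (4 + 2 * e * l) ≤ 48 * e ^ 2 * s := by
      calc e * l * (4 + 2 * e * l) = 4 * e * l + 2 * e ^ 2 * l ^ 2 := by ring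
        _ ≤ 4 * e * (4 * s) + 2 * e ^ 2 * (16 * s) := by gcongr
        _ ≤ 4 * (e * e) * (4 * s) + 2 * e ^ 2 * (16 * s) := by
            gcongr; nlinarith
        _ = _ := by ring
    have h5 : 48 * e ^ 2 * s ≤ 2 * B * (gd * μ) := by
      rw [hgμ]
      calc 48 * e ^ 2 * s ≤ 48 * e ^ 2 * (2 ^ p.d * (p.n / p.numChunks)) := by gcongr
        _ = 2 * (24 * e ^ 2 * 2 ^ p.d) * (p.n / p.numChunks) := by ring
        _ ≤ _ := by gcongr; exact le_add_of_nonneg_right (by positivity)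
    calc e * l * (2 * (2 * μ + e * l) + 1 + 4 * μ) ≤ e * l * ((4 + 2 * e * l) * (1 + 2 * μ)) := by
          gcongr
          have : 0 ≤ e * l * μ := by positivity
          nlinarith
      _ = e * l * (4 + 2 * e * l) * (1 + 2 * μ) := by ring
      _ ≤ 2 * B * (gd * μ) * (1 + 2 * μ) :=
          mul_le_mul_of_nonneg_right (h4.trans h5) (by positivity)
      _ = _ := by ring
  have hPn : p.P ≤ p.n := (Nat.le_mul_of_pos_left _ p.numChunks_pos).trans hk
  refine le_trans (measure_mono ?_)
    (p.occupancy_concentration hc hn hPn hμ hGn rfl hσ hnum)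
  intro X hX hX'
  refine hX ?_
  obtain ⟨hcube, -, hsq⟩ := hX'
  refine ⟨hcube, fun i => ?_⟩
  have hsize : (p.n : ℝ) / p.P ≤ p.size / p.P := by
    gcongr; exact le_add_of_nonneg_left (by have := lt_min hr one_pos; positivity)
  have w1 := p.recursionVariates_le hd hP hb i
  have w2 : (p.cellVariates i : ℝ) ≤ 6 ^ p.d * (p.n / p.P) := by
    rw [cellVariates]; push_cast
    exact mul_le_mul (hGen i) hgn (by positivity) (by positivity)
  have hmin : min (2 * p.reach + 1) p.cellsPerDim ≤ 3 := (min_le_left _ _).trans (by omega)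
  have w3 : (p.cellVisits i : ℝ) ≤ 6 ^ p.d * (p.n / p.P) := by
    have h : p.cellVisits i ≤ 6 ^ p.d * p.cellsPerChunkDim ^ p.d := by
      refine (p.cellVisits_le hd i).trans ((Nat.mul_le_mul_left _
        (Nat.pow_le_pow_left hmin _)).trans (le_of_eq ?_))
      rw [mul_right_comm, ← mul_pow]
      norm_num
    have h' : (p.cellVisits i : ℝ) ≤ 6 ^ p.d * gd := by rw [hgd]; exact_mod_cast h
    exact h'.trans (by gcongr)
  have w4 : (p.vertexSamples i X + p.distanceComputations i X : ℝ) ≤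
      36 * 6 ^ p.d * B * (p.size / p.P) := by
    have h : p.vertexSamples i X + p.distanceComputations i X ≤
        3 * 3 ^ p.d * ∑ C ∈ p.generatedCells i, occ (p.labels X) C ^ 2 := by
      refine (p.vertexSamples_add_distanceComputations_le i hcube).trans
        (Nat.mul_le_mul_right _ ?_)
      have h1 := Nat.pow_le_pow_left hmin p.d
      have h2 : 1 ≤ 3 ^ p.d := Nat.one_le_pow _ _ (by norm_num)
      omega
    have h' : (p.vertexSamples i X + p.distanceComputations i X : ℝ) ≤
        3 * 3 ^ p.d * ∑ C ∈ p.generatedCells i, (occ (p.labels X) C : ℝ) ^ 2 := by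
      exact_mod_cast h
    -- One factor g^d μ = n/k is at most n/P; the other factor μ gives n²/G^d together with n.
    have hfin : gd * μ ^ 2 ≤ 2 ^ p.d * (p.size / p.P) := by
      calc gd * μ ^ 2 = (p.n / p.numChunks) * μ := by rw [← hgμ]; ring
        _ ≤ p.n / p.P * μ := by gcongr
        _ = p.n ^ 2 / (p.cellsPerDim : ℝ) ^ p.d / p.P := by rw [hμ]; ring
        _ ≤ 2 ^ p.d * p.size / p.P := by
            gcongr
            rw [div_le_iff₀ hG0]
            have := p.sq_le_cellsPerDim_pow_mul hd hn1 hr hrb hkn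
            rw [size]; linarith
        _ = _ := by ring
    calc (p.vertexSamples i X + p.distanceComputations i X : ℝ)
        ≤ 3 * 3 ^ p.d * (4 * (B * gd) * (μ + 2 * μ ^ 2)) := h'.trans (by gcongr; exact hsq i)
      _ ≤ 3 * 3 ^ p.d * (4 * (B * gd) * (μ ^ 2 + 2 * μ ^ 2)) := by gcongr; nlinarith
      _ = 36 * 3 ^ p.d * B * (gd * μ ^ 2) := by ring
      _ ≤ 36 * 3 ^ p.d * B * (2 ^ p.d * (p.size / p.P)) := by gcongr
      _ = 36 * (3 * 2) ^ p.d * B * (p.size / p.P) := by rw [mul_pow]; ring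
      _ = _ := by norm_num
  rw [work_eq]
  have v1 := w1.trans (mul_le_mul_of_nonneg_left hsize (by positivity))
  have v2 := w2.trans (mul_le_mul_of_nonneg_left hsize (by positivity))
  have v3 := w3.trans (mul_le_mul_of_nonneg_left hsize (by positivity))
  linarith

/-- The work bound for `r` larger than the side length of a chunk. -/
lemma work_concentration_of_lt {c : ℝ} (hc : 0 < c) (hd : 1 ≤ p.d) (hP : 1 ≤ p.P)
    (hn : 2 ≤ p.n) (hr : 0 < p.r) (hrb : 1 / 2 ^ p.depth < p.r)
    (hb : p.P * p.P * p.depth ≤ p.n) (hk : p.numChunks * p.P ≤ p.n) :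
    uniformPoints p.n p.d {X | ¬ (InCube X ∧ ∀ i, (p.work i X : ℝ) ≤
      (4 ^ p.d + 2 * 6 ^ p.d + 3 * 10 ^ p.d * (2 + 4 * (c + 2) * 2 ^ p.d) ^ 2) *
        (p.size / p.P))} ≤ ENNReal.ofReal ((p.n : ℝ) ^ (-c)) := by
  have hkn : p.numChunks ≤ p.n := (Nat.le_mul_of_pos_right _ hP).trans hk
  have hn1 : 1 ≤ p.n := by omega
  have hP' : (0 : ℝ) < p.P := by exact_mod_cast hP
  have hn' : (0 : ℝ) < p.n := by exact_mod_cast hn1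
  have hk0 : (0 : ℝ) < p.numChunks := by exact_mod_cast p.numChunks_pos
  have hPk : (p.P : ℝ) ≤ p.numChunks := by exact_mod_cast p.le_numChunks hd
  have hg := p.cellsPerChunkDim_eq_one hr hrb
  have hGk : p.cellsPerDim ^ p.d = p.numChunks := by rw [cellsPerDim_pow, hg, one_pow, mul_one]
  have hGk' : (p.cellsPerDim : ℝ) ^ p.d = p.numChunks := by exact_mod_cast hGk
  set μ : ℝ := p.n / (p.cellsPerDim : ℝ) ^ p.d with hμ
  have hμk : μ = p.n / p.numChunks := by rw [hμ, hGk']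
  have hμ1 : 1 ≤ μ := by rw [hμk]; exact (one_le_div hk0).2 (by exact_mod_cast hkn)
  have hlog : 0 ≤ Real.log p.n := Real.log_nonneg (by exact_mod_cast hn1)
  set β : ℝ := 2 * μ + (c + 2) * Real.log p.n with hβ
  have hβ1 : 1 ≤ β := by
    have : 0 ≤ (c + 2) * Real.log p.n := by positivity
    linarith
  set D : ℝ := 2 + 4 * (c + 2) * 2 ^ p.d with hD
  -- Here μ = n/k, so the logarithmic term of β is itself O(μ): no cell is overfull by more than a
  -- constant factor.
  have hβμ : β ≤ D * μ := by
    have h1 := log_le_four_mul_sqrt (x := p.n) (by exact_mod_cast hn1)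
    have h2 := p.sqrt_le_div_numChunks hd hP hk
    rw [← hμk] at h2
    calc β ≤ 2 * μ + (c + 2) * (4 * (2 ^ p.d * μ)) := by rw [hβ]; gcongr; linarith
      _ = _ := by rw [hD]; ring
  -- Only the bound on the single occupancies is used below; σ is simply taken large enough to meet
  -- the hypotheses of the concentration lemma.
  set σ : ℝ := p.cells.card + (c + 2) * Real.log p.n * (2 * β + 1 + 4 * μ) with hσdef
  have hσ : ∀ i, ((p.generatedCells i).card : ℝ) ≤ σ := fun i => by
    have : ((p.generatedCells i).card : ℝ) ≤ p.cells.card := by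
      exact_mod_cast Finset.card_le_card (p.generatedCells_subset_cells i)
    exact this.trans (le_add_of_nonneg_right (by positivity))
  have hnum : (c + 2) * Real.log p.n ≤ 2 * σ * (μ + 2 * μ ^ 2) / (2 * β + 1 + 4 * μ) := by
    rw [le_div_iff₀ (by positivity)]
    have h1 : (c + 2) * Real.log p.n * (2 * β + 1 + 4 * μ) ≤ σ :=
      le_add_of_nonneg_left (by positivity)
    have h2 : 0 ≤ σ := le_trans (by positivity) h1
    nlinarith
  have hPn : p.P ≤ p.n := (Nat.le_mul_of_pos_left _ p.numChunks_pos).trans hk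
  refine le_trans (measure_mono ?_)
    (p.occupancy_concentration hc hn hPn hμ (hGk.le.trans hkn) hβ hσ hnum)
  intro X hX hX'
  refine hX ?_
  obtain ⟨hcube, hocc, -⟩ := hX'
  refine ⟨hcube, fun i => ?_⟩
  have hρ := lt_min hr one_pos
  have hsize : (p.n : ℝ) / p.P ≤ p.size / p.P := by
    gcongr; exact le_add_of_nonneg_left (by positivity)
  have hkP : (p.numChunks : ℝ) ≤ p.n / p.P := by
    rw [le_div_iff₀ hP']; exact_mod_cast hk
  have w1 := p.recursionVariates_le hd hP hb i
  have w2 : (p.cellVariates i : ℝ) ≤ 6 ^ p.d * (p.n / p.P) := by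
    rw [cellVariates, hg, one_pow, mul_one]
    have h1 : ((p.generatedChunks i).card : ℝ) ≤ p.numChunks := by
      exact_mod_cast p.card_generatedChunks_le i
    have h2 : (1 : ℝ) ≤ 6 ^ p.d := one_le_pow₀ (by norm_num)
    exact (h1.trans hkP).trans (le_mul_of_one_le_left (by positivity) h2)
  have hvis : (p.cellVisits i : ℝ) ≤
      2 ^ p.d * ((min (2 * p.reach + 1) p.cellsPerDim : ℕ) : ℝ) ^ p.d := by
    have h := p.cellVisits_le hd i
    rw [hg, one_pow, mul_one] at h
    exact_mod_cast h
  have w3 : (p.cellVisits i : ℝ) ≤ 6 ^ p.d * (p.n / p.P) := by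
    calc (p.cellVisits i : ℝ) ≤ 2 ^ p.d * (p.cellsPerDim : ℝ) ^ p.d := hvis.trans (by
          gcongr; exact min_le_right _ _)
      _ ≤ 6 ^ p.d * (p.n / p.P) := by
          rw [hGk']; gcongr; norm_num
  have w4 : (p.vertexSamples i X + p.distanceComputations i X : ℝ) ≤
      3 * 10 ^ p.d * D ^ 2 * (p.size / p.P) := by
    -- For a full grid the pairs would cost kμ² = n²/k; the factor min(r,1)^d from the reach reduces
    -- this to `size`/P.
    have hkμ : (p.numChunks : ℝ) * μ ^ 2 ≤ p.n ^ 2 / p.P := by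
      calc (p.numChunks : ℝ) * μ ^ 2 = p.n ^ 2 / p.numChunks := by rw [hμk]; field_simp
        _ ≤ _ := by gcongr
    calc (p.vertexSamples i X + p.distanceComputations i X : ℝ)
        ≤ 3 * p.cellVisits i * β ^ 2 :=
          p.vertexSamples_add_distanceComputations_le_of_occ_le i hcube hβ1 hocc
      _ ≤ 3 * (2 ^ p.d * (5 * min p.r 1 * p.cellsPerDim) ^ p.d) * (D * μ) ^ 2 := by
          gcongr
          exact hvis.trans (by gcongr; exact p.min_reach_le hr hrb)
      _ = 3 * (2 * 5) ^ p.d * D ^ 2 * ((min p.r 1) ^ p.d * (p.numChunks * μ ^ 2)) := by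
          rw [← hGk']; simp only [mul_pow]; ring
      _ ≤ 3 * (2 * 5) ^ p.d * D ^ 2 * ((min p.r 1) ^ p.d * (p.n ^ 2 / p.P)) := by gcongr
      _ = 3 * (2 * 5) ^ p.d * D ^ 2 * (p.n ^ 2 * (min p.r 1) ^ p.d / p.P) := by ring
      _ ≤ 3 * (2 * 5) ^ p.d * D ^ 2 * (p.size / p.P) := by
          gcongr; exact le_add_of_nonneg_right hn'.le
      _ = _ := by norm_num
  rw [work_eq]
  have v1 := w1.trans (mul_le_mul_of_nonneg_left hsize (by positivity))
  have v2 := w2.trans (mul_le_mul_of_nonneg_left hsize (by positivity))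
  have v3 := w3.trans (mul_le_mul_of_nonneg_left hsize (by positivity))
  linarith

/-- The lower bound on `n` in the form in which the work bounds use it. -/
lemma size_conditions (hd : 1 ≤ p.d) (hP : 1 ≤ p.P) (hn : 1 ≤ p.n)
    (h : (7 + 4 * 2 ^ p.d) * (p.P : ℝ) ^ 2 * Real.log p.P ^ 3 ≤ p.n) :
    p.P * p.P * p.depth ≤ p.n ∧ p.numChunks * p.P ≤ p.n := by
  rcases hP.eq_or_lt with h1 | h1
  · rw [p.depth_eq_zero h1.symm, p.numChunks_eq_one h1.symm, ← h1]
    omega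
  · have hL : Real.log 2 ≤ Real.log p.P :=
      Real.log_le_log two_pos (by exact_mod_cast h1)
    have hl2 := Real.log_two_gt_d9
    set L := Real.log p.P with hLdef
    have hL1 : 0.69 ≤ L := by linarith
    have hLsq : 0.476 ≤ L ^ 2 := by nlinarith
    have hLcu : 0.328 ≤ L ^ 3 := by nlinarith
    -- 2^(b-1) < P gives (b-1) log 2 ≤ L, and the missing 1 is at most L / log 2 since P ≥ 2. The
    -- constant 7 then comes from 3L ≤ 7L³, and the constant 4 from 1 ≤ 4L³.
    have hb : (p.depth : ℝ) ≤ 3 * L := by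
      have h3 : 1 < 2 ^ p.d := Nat.one_lt_two_pow (by omega)
      have h4 : 0 < p.depth := Nat.clog_pos h3 h1
      have h5 : 2 ^ p.depth.pred < p.P :=
        (Nat.pow_le_pow_left (Nat.le_self_pow (by omega : p.d ≠ 0) 2) _).trans_lt
          (Nat.pow_pred_clog_lt_self h3 h1)
      have h6 : ((p.depth - 1 : ℕ) : ℝ) * Real.log 2 ≤ L := by
        rw [← Real.log_pow]
        exact Real.log_le_log (by positivity) (by exact_mod_cast h5.le)
      rw [Nat.cast_sub h4, Nat.cast_one] at h6
      nlinarith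
    have hb' : (p.depth : ℝ) ≤ 7 * L ^ 3 := hb.trans (by nlinarith)
    have hnn : 0 ≤ (p.P : ℝ) ^ 2 * L ^ 3 := by positivity
    have hd2 : (0 : ℝ) < 2 ^ p.d := by positivity
    constructor
    · have : (p.P : ℝ) * p.P * p.depth ≤ p.n := by
        calc (p.P : ℝ) * p.P * p.depth ≤ p.P * p.P * (7 * L ^ 3) := by gcongr
          _ = 7 * (p.P ^ 2 * L ^ 3) := by ring
          _ ≤ (7 + 4 * 2 ^ p.d) * (p.P ^ 2 * L ^ 3) := by gcongr; linarith
          _ ≤ p.n := by linarith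
      exact_mod_cast this
    · have : (p.numChunks : ℝ) * p.P ≤ p.n := by
        calc (p.numChunks : ℝ) * p.P ≤ (2 ^ p.d * p.P) * p.P := by
              gcongr; exact_mod_cast p.numChunks_le hd hP
          _ = 2 ^ p.d * p.P ^ 2 * 1 := by ring
          _ ≤ 2 ^ p.d * p.P ^ 2 * (4 * L ^ 3) := by gcongr; linarith
          _ = (4 * 2 ^ p.d) * (p.P ^ 2 * L ^ 3) := by ring
          _ ≤ (7 + 4 * 2 ^ p.d) * (p.P ^ 2 * L ^ 3) := by gcongr; linarith
          _ ≤ p.n := by linarith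
      exact_mod_cast this

/-- The constant of the work bound, relative to `size`. -/
noncomputable def workConst (d : ℕ) (c : ℝ) : ℝ :=
  4 ^ d + 2 * 6 ^ d + 36 * 6 ^ d * (24 * (c + 2) ^ 2 * 2 ^ d + 6 ^ d) +
    3 * 10 ^ d * (2 + 4 * (c + 2) * 2 ^ d) ^ 2

lemma workConst_pos (d : ℕ) {c : ℝ} (hc : 0 < c) : 0 < workConst d c := by
  unfold workConst; positivity

lemma size_nonneg (hr : 0 < p.r) : 0 ≤ p.size := by
  have := lt_min hr one_pos
  unfold size; positivity

lemma work_concentration {c : ℝ} (hc : 0 < c) (hd : 1 ≤ p.d) (hP : 1 ≤ p.P)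
    (hn : 2 ≤ p.n) (hr : 0 < p.r) (hb : p.P * p.P * p.depth ≤ p.n)
    (hk : p.numChunks * p.P ≤ p.n) :
    uniformPoints p.n p.d {X | ¬ (InCube X ∧ ∀ i, (p.work i X : ℝ) ≤
      workConst p.d c * (p.size / p.P))} ≤ ENNReal.ofReal ((p.n : ℝ) ^ (-c)) := by
  have h0 := p.size_nonneg hr
  rcases le_or_gt p.r (1 / 2 ^ p.depth) with h | h
  · refine le_trans (measure_mono ?_) (p.work_concentration_of_le hc hd hP hn hr h hb hk)
    intro X hX hX'
    refine hX ⟨hX'.1, fun i => (hX'.2 i).trans ?_⟩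
    gcongr
    exact le_add_of_nonneg_right (by positivity)
  · refine le_trans (measure_mono ?_) (p.work_concentration_of_lt hc hd hP hn hr h hb hk)
    intro X hX hX'
    refine hX ⟨hX'.1, fun i => (hX'.2 i).trans ?_⟩
    gcongr
    have : 0 ≤ 36 * 6 ^ p.d * (24 * (c + 2) ^ 2 * 2 ^ p.d + 6 ^ p.d : ℝ) := by positivity
    unfold workConst
    linarith

end Params

end RGG

theorem mainTheorem3 (d : ℕ) (hd : 1 ≤ d) (c : ℝ) (hc : 0 < c) :
    ∃ a : ℝ, 0 < a ∧ ∃ K : ℝ, 0 < K ∧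
      ∀ (n P : ℕ) (r : ℝ), 1 ≤ n → 1 ≤ P → 0 < r →
        a * (P : ℝ) ^ 2 * Real.log P ^ 3 ≤ n →
        ENNReal.ofReal (1 - (n : ℝ) ^ (-c)) ≤
          RGG.uniformPoints n d {X | ∀ i : Fin P,
            ((RGG.Params.mk d n P r).work i X : ℝ) ≤ K * ((RGG.numEdges r X + n) / P) ∧
            ((RGG.Params.mk d n P r).work i X : ℝ) ≤ K * ((RGG.expEdges n d r + n) / P)} := by
  have hW := RGG.Params.workConst_pos d hc
  refine ⟨7 + 4 * 2 ^ d, by positivity, RGG.Params.workConst d c * (3 * (√d + 1) ^ d),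
    by positivity, fun n P r hn hP hr h => ?_⟩
  -- For n = 1 the claimed probability is 1 - 1 = 0.
  rcases hn.eq_or_lt with h1 | h1
  · rw [← h1]; simp
  have hP' : (0 : ℝ) < P := by exact_mod_cast hP
  let p : RGG.Params := ⟨d, n, P, r⟩
  obtain ⟨hb, hk⟩ := p.size_conditions hd hP hn h
  set S := {X : Fin n → Fin d → ℝ | ∀ i : Fin P,
    (p.work i X : ℝ) ≤ RGG.Params.workConst d c * (3 * (√d + 1) ^ d) *
      ((RGG.numEdges r X + n) / P) ∧
    (p.work i X : ℝ) ≤ RGG.Params.workConst d c * (3 * (√d + 1) ^ d) *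
      ((RGG.expEdges n d r + n) / P)} with hS
  have hbad : RGG.uniformPoints n d Sᶜ ≤ ENNReal.ofReal ((n : ℝ) ^ (-c)) := by
    refine le_trans (measure_mono ?_) (p.work_concentration hc hd hP h1 hr hb hk)
    intro X hX hX'
    refine hX fun i => ?_
    have e1 := RGG.le_numEdges_add hr hX'.1
    have e2 := RGG.le_expEdges_add (n := n) (d := d) hr
    constructor
    · refine (hX'.2 i).trans ?_
      rw [mul_assoc (RGG.Params.workConst d c), ← mul_div_assoc (3 * (√d + 1) ^ d)]
      exact mul_le_mul_of_nonneg_left (div_le_div_of_nonneg_right e1 hP'.le) hW.le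
    · refine (hX'.2 i).trans ?_
      rw [mul_assoc (RGG.Params.workConst d c), ← mul_div_assoc (3 * (√d + 1) ^ d)]
      exact mul_le_mul_of_nonneg_left (div_le_div_of_nonneg_right e2 hP'.le) hW.le
  -- Subadditivity suffices to pass to the complement, so measurability of the event need not be
  -- shown.
  have huniv : 1 ≤ RGG.uniformPoints n d S + RGG.uniformPoints n d Sᶜ := by
    rw [← measure_univ (μ := RGG.uniformPoints n d), ← Set.union_compl_self S]
    exact measure_union_le _ _
  rw [ENNReal.ofReal_sub _ (by positivity), ENNReal.ofReal_one]
  exact tsub_le_iff_right.2 (huniv.trans (add_le_add_right hbad _))
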